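/- Let $d, p \ge 1$ be integers, $\mu \in \mathbb{R}$, $r > d/2$, $0 < \gamma \le 1$ and $T \ge 0$. For $s \ge 0$ let $H^s = H^s(\mathbb{T}^d)$, $\mathbb{T} = \mathbb{R}/2\pi\mathbb{Z}$, with norm $\|f\|_s^2 = \sum_{k\in\mathbb{Z}^d} (1+|k|)^{2s} |\hat f_k|^2$. Let $u \in C([0,T];H^r)$ be an exact (mild) solution of the nonlinear Schrödinger equation $$ i\partial_t u = -\Delta u + \mu |u|^{2p} u \quad\text{on } \mathbb{T}^d, $$ that is, $u(t) = e^{it\Delta}u(0) - i\mu\int_0^t e^{i(t-\sigma)\Delta}\big[|u(\sigma)|^{2p}u(\sigma)\big]\,d\sigma$ for $0 \le t \le T$. Assume that $u(t) \in H^{r+\gamma}$ for $0 \le t \le T$, with $\sup_{0\le t\le T}\|u(t)\|_{r+\gamma} \le M < \infty$. For a step size $\tau > 0$ let $t_n = n\tau$, $u^0 = u(0)$ and $$ u^{n+1} = e^{i\tau\Delta}\Big[ u^n - i\mu\tau\, (u^n)^{p+1}\, \Big(\varphi_1(-2i\tau\Delta)\,\big(\overline{u^n}\big)^p\Big)\Big],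 \qquad \varphi_1(z) = \frac{e^z-1}{z},\quad \varphi_1(0)=1 . $$ Then there exist constants $\tau_0 > 0$ and $c > 0$, depending only on $d, p, \mu, r, \gamma, T$ and $M$ (and otherwise not on $u$), such that for all step sizes $0 < \tau \le \tau_0$ and all integers $n \ge 0$ with $t_n \le T$ we have $u^n \in H^r$ and $$ \|u(t_n) - u^n\|_r \le c\,\tau^\gamma . $$ In particular (the case $\gamma = 1$) the integrator converges with first order in $H^r$ for solutions that are bounded in $H^{r+1}$. -/

import Mathlib

open MeasureTheory Filter Topology

noncomputable section

namespace NLS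

instance factTwoPiPos : Fact (0 < 2 * Real.pi) := ⟨Real.two_pi_pos⟩

/-- The torus `𝕋^d = (ℝ / 2πℤ)^d`. -/
abbrev Torus (d : ℕ) : Type := Fin d → AddCircle (2 * Real.pi)

/-- The normalized measure `(2π)^{-d} dx` on `𝕋^d`. -/
def torusMeasure (d : ℕ) : Measure (Torus d) :=
  Measure.pi fun _ => AddCircle.haarAddCircle

/-- The exponential `x ↦ e^{i k·x} = ∏ⱼ e^{i kⱼ xⱼ}` for `k ∈ ℤ^d`. -/
def expMode {d : ℕ} (k : Fin d → ℤ) (x : Torus d) : ℂ :=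
  ∏ j, (fourier (k j) (x j) : ℂ)

/-- The Fourier coefficient `f̂_k = (2π)^{-d} ∫ f(x) e^{-i k·x} dx`. -/
def coeff {d : ℕ} (f : Torus d → ℂ) (k : Fin d → ℤ) : ℂ :=
  ∫ x, expMode (-k) x * f x ∂(torusMeasure d)

/-- `|k|² = k₁² + ⋯ + k_d²`. -/
def modeSq {d : ℕ} (k : Fin d → ℤ) : ℝ := ∑ j, (k j : ℝ) ^ 2

/-- The weight `(1 + |k|)^{2s}` of the Sobolev norm, `|k|` being the Euclidean length. -/
def sobolevWeight {d : ℕ} (s : ℝ) (k : Fin d → ℤ) : ℝ :=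
  (1 + Real.sqrt (modeSq k)) ^ (2 * s)

/-- Membership in `H^s(𝕋^d)`, `s ≥ 0`: the square-integrable functions with
`∑_k (1 + |k|)^{2s} |f̂_k|² < ∞`. -/
def MemSobolev {d : ℕ} (s : ℝ) (f : Torus d → ℂ) : Prop :=
  MemLp f 2 (torusMeasure d) ∧ Summable fun k => sobolevWeight s k * ‖coeff f k‖ ^ 2

/-- The norm `‖f‖_s = (∑_k (1 + |k|)^{2s} |f̂_k|²)^{1/2}` of `f ∈ H^s(𝕋^d)`. -/
def sobolevNorm {d : ℕ} (s : ℝ) (f : Torus d → ℂ) : ℝ :=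
  Real.sqrt (∑' k, sobolevWeight s k * ‖coeff f k‖ ^ 2)

/-- The Fourier multiplier `g(Δ) f = ∑_k g(-|k|²) f̂_k e^{i k·x}`. The series converges absolutely
and uniformly if `g` is bounded on `(-∞, 0]` and `f ∈ H^s` with `s > d/2`; all uses are of
this kind. -/
def laplaceMultiplier {d : ℕ} (g : ℂ → ℂ) (f : Torus d → ℂ) (x : Torus d) : ℂ :=
  ∑' k : Fin d → ℤ, g (-(modeSq k : ℂ)) * coeff f k * expMode k x

/-- The free Schrödinger group `e^{itΔ}`. -/
def freeGroup {d : ℕ} (t : ℝ) : (Torus d → ℂ) → Torus d → ℂ :=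
  laplaceMultiplier fun z => Complex.exp (Complex.I * t * z)

/-- `φ₁(z) = (e^z - 1)/z`, continuously extended by `φ₁(0) = 1`. -/
def phi1 (z : ℂ) : ℂ := if z = 0 then 1 else (Complex.exp z - 1) / z

/-- The nonlinearity `|f|^{2p} f`. -/
def nonlinearity {d : ℕ} (p : ℕ) (f : Torus d → ℂ) (x : Torus d) : ℂ :=
  (‖f x‖ : ℂ) ^ (2 * p) * f x

/-- `u ∈ C([0,T]; H^s)`, `s > d/2`, solves `i ∂ₜu = -Δu + μ |u|^{2p} u` in the mild sense,
`u(t) = e^{itΔ} u(0) - i μ ∫₀ᵗ e^{i(t-σ)Δ} [|u(σ)|^{2p} u(σ)] dσ` for `0 ≤ t ≤ T`.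
The identity in `H^s` is written out for each Fourier coefficient. -/
structure IsSolution {d : ℕ} (p : ℕ) (μ s T : ℝ) (u : ℝ → Torus d → ℂ) : Prop where
  mem : ∀ t ∈ Set.Icc 0 T, MemSobolev s (u t)
  continuous : ∀ t ∈ Set.Icc 0 T,
    Tendsto (fun t' => sobolevNorm s (u t' - u t)) (𝓝[Set.Icc 0 T] t) (𝓝 0)
  duhamel : ∀ t ∈ Set.Icc 0 T, ∀ k : Fin d → ℤ,
    coeff (u t) k = coeff (freeGroup t (u 0)) k
      - Complex.I * μ * ∫ σ in (0 : ℝ)..t, coeff (freeGroup (t - σ) (nonlinearity p (u σ))) k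

/-- One step of the exponential-type integrator,
`w ↦ e^{iτΔ} [w - i μ τ w^{p+1} (φ₁(-2iτΔ) w̄^p)]`. -/
def step {d : ℕ} (p : ℕ) (μ τ : ℝ) (w : Torus d → ℂ) : Torus d → ℂ :=
  freeGroup τ fun x => w x - Complex.I * μ * τ * w x ^ (p + 1) *
    laplaceMultiplier (fun z => phi1 (-2 * Complex.I * τ * z))
      (fun y => (starRingEnd ℂ (w y)) ^ p) x

/-- The numerical solution `uⁿ` with step size `τ` started at `u⁰`. -/
def numSol {d : ℕ} (p : ℕ) (μ τ : ℝ) (u0 : Torus d → ℂ) : ℕ → Torus d → ℂ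
  | 0 => u0
  | n + 1 => step p μ τ (numSol p μ τ u0 n)

end NLS

end

noncomputable section
namespace NLS

variable {d : ℕ}

/-! The scheme is stable in `H^r` and its local error is `O(τ^{1+γ})`; summing the propagated local
errors over at most `T/τ` steps gives `O(τ^γ)`.

For the local error, write Duhamel's formula on `[t, t+τ]` with `w = u(t)`. In the integrand
`u(t+σ)` may be replaced by `e^{iσΔ}w` at the cost of `O(σ)`, because `H^r` is an algebra for `r >
d/2` (`increment_bound`, `multNonlin_sub_bound`). Conjugation reverses the flow, so `conj(e^{iσΔ}w)
= e^{iσΔ} e^{-2iσΔ} w̄`. Pulling `e^{iσΔ}` out of all products leads to `e^{iσΔ}[w^{p+1} e^{-2iσΔ}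
w̄^p]` (`multNonlin_freeGroup_sub_bound`). This last integrand can be integrated exactly: the
integral of `e^{-2iσΔ}` over `[0,τ]` is `τ φ₁(-2iτΔ)`, and the result is one step of the scheme
(`integral_coeff_multNonlin`).

The crux is the price of pulling the flow out of a product (`SobolevBound.freeGroup_mul`). On a pair
of frequencies `l, m` the phases mismatch by `θ = 2σ l·m`, and `|e^{iθ}-1| ≤ 2|θ|^γ`. The inner
product puts `γ` derivatives on each factor rather than `2γ` on one of them, so `H^{r+γ}` suffices
for an error `O(σ^γ)` in `H^r`.

Stability (`step_sub_bound`) holds on the ball of radius `M+1` in `H^r`. The iterates stay there by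
induction, as long as the error bound itself is at most `1` (`global_error_bound`).

All estimates are made on Fourier coefficients of continuous representatives; `SeqBound` tests the
weighted `ℓ²` norm on finite sets of frequencies. -/

instance isProbabilityMeasure_torusMeasure (d : ℕ) : IsProbabilityMeasure (torusMeasure d) :=
  inferInstanceAs (IsProbabilityMeasure (Measure.pi fun _ => AddCircle.haarAddCircle))

/-! ### Exponentials -/

theorem continuous_expMode (k : Fin d → ℤ) : Continuous (expMode k) := by
  unfold expMode
  fun_prop

theorem norm_expMode (k : Fin d → ℤ) (x : Torus d) : ‖expMode k x‖ = 1 := by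
  simp only [expMode, norm_prod]
  exact Finset.prod_eq_one fun j _ => Circle.norm_coe _

theorem expMode_add (k l : Fin d → ℤ) (x : Torus d) :
    expMode (k + l) x = expMode k x * expMode l x := by
  simp only [expMode, Pi.add_apply, fourier_add, Finset.prod_mul_distrib]

theorem expMode_zero (x : Torus d) : expMode 0 x = 1 := by
  simp [expMode]

theorem expMode_neg (k : Fin d → ℤ) (x : Torus d) :
    expMode (-k) x = (starRingEnd ℂ) (expMode k x) := by
  simp only [expMode, Pi.neg_apply, fourier_neg, map_prod]

theorem integral_expMode (k : Fin d → ℤ) :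
    ∫ x, expMode k x ∂(torusMeasure d) = if k = 0 then 1 else 0 := by
  split_ifs with h
  · simp [h, expMode_zero]
  · unfold expMode torusMeasure
    rw [integral_fintype_prod_eq_prod (𝕜 := ℂ) (E := fun _ => AddCircle (2 * Real.pi))
      (f := fun j y => (fourier (k j) y : ℂ))]
    obtain ⟨i, hi⟩ := Function.ne_iff.mp h
    apply Finset.prod_eq_zero (Finset.mem_univ i)
    have h1 := (orthonormal_iff_ite.mp (orthonormal_fourier (T := 2 * Real.pi))) 0 (k i)
    rw [ContinuousMap.inner_toLp, if_neg (fun h' => hi (by simpa using h'.symm))] at h1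
    simpa only [fourier_zero, map_one, mul_one, one_mul] using h1

/-- The exponential as a bundled continuous map. -/
def expModeC (k : Fin d → ℤ) : C(Torus d, ℂ) := ⟨expMode k, continuous_expMode k⟩

/-- Stone–Weierstrass: conjugation sends mode `k` to `-k`, products add frequencies, so the span is
a star algebra, and the modes of a single coordinate already separate points. -/
theorem span_expModeC_closure_eq_top :
    (Submodule.span ℂ (Set.range (expModeC (d := d)))).topologicalClosure = ⊤ := by
  have hstar : Algebra.adjoin ℂ (Set.range (expModeC (d := d))) ≤
      star (Algebra.adjoin ℂ (Set.range (expModeC (d := d)))) := by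
    refine Algebra.adjoin_le ?_
    rintro _ ⟨n, rfl⟩
    refine Algebra.subset_adjoin ⟨-n, ?_⟩
    ext1 x
    simp only [expModeC, ContinuousMap.coe_mk, expMode_neg, starRingEnd_apply,
      ContinuousMap.star_apply]
  let A : StarSubalgebra ℂ C(Torus d, ℂ) :=
    { toSubalgebra := Algebra.adjoin ℂ (Set.range (expModeC (d := d)))
      star_mem' := fun {a} ha => hstar ha }
  have hA : A.toSubalgebra.toSubmodule = Submodule.span ℂ (Set.range (expModeC (d := d))) := by
    apply Algebra.adjoin_eq_span_of_subset
    refine .trans (fun x ↦ Submonoid.closure_induction (fun _ ↦ id) ⟨0, ?_⟩ ?_)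
      Submodule.subset_span
    · ext z
      simp [expModeC, expMode_zero]
    · rintro _ _ _ _ ⟨m, rfl⟩ ⟨n, rfl⟩
      refine ⟨m + n, ?_⟩
      ext z
      simp [expModeC, expMode_add]
  have hsep : A.SeparatesPoints := by
    intro x y hxy
    obtain ⟨i, hi⟩ := Function.ne_iff.mp hxy
    refine ⟨_, ⟨expModeC (Pi.single i 1), Algebra.subset_adjoin ⟨Pi.single i 1, rfl⟩, rfl⟩, ?_⟩
    have key : ∀ z : Torus d, expMode (Pi.single i 1) z = fourier 1 (z i) := by
      intro z
      rw [expMode, Finset.prod_eq_single i]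
      · simp
      · intro b _ hb
        simp [hb]
      · simp
    change expMode (Pi.single i 1) x ≠ expMode (Pi.single i 1) y
    rw [key, key, fourier_one, fourier_one]
    contrapose hi
    exact AddCircle.injective_toCircle Real.two_pi_pos.ne' (Circle.ext hi)
  rw [← hA]
  exact congr_arg (Subalgebra.toSubmodule <| StarSubalgebra.toSubalgebra ·)
    (ContinuousMap.starSubalgebra_topologicalClosure_eq_top_of_separatesPoints _ hsep)

/-! ### Fourier coefficients -/

theorem coeff_congr_ae {f g : Torus d → ℂ} (h : f =ᵐ[torusMeasure d] g) : coeff f = coeff g := by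
  funext k
  refine integral_congr_ae ?_
  filter_upwards [h] with x hx
  rw [hx]

theorem integrable_expMode_mul {f : Torus d → ℂ} (hf : Integrable f (torusMeasure d))
    (k : Fin d → ℤ) : Integrable (fun x => expMode k x * f x) (torusMeasure d) :=
  hf.bdd_mul (c := 1) (continuous_expMode k).aestronglyMeasurable
    (ae_of_all _ fun x => (norm_expMode k x).le)

theorem coeff_sub {f g : Torus d → ℂ} (hf : Integrable f (torusMeasure d))
    (hg : Integrable g (torusMeasure d)) (k : Fin d → ℤ) :
    coeff (f - g) k = coeff f k - coeff g k := by
  simp only [coeff, Pi.sub_apply, mul_sub]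
  exact integral_sub (integrable_expMode_mul hf _) (integrable_expMode_mul hg _)

theorem coeff_add {f g : Torus d → ℂ} (hf : Integrable f (torusMeasure d))
    (hg : Integrable g (torusMeasure d)) (k : Fin d → ℤ) :
    coeff (f + g) k = coeff f k + coeff g k := by
  simp only [coeff, Pi.add_apply, mul_add]
  exact integral_add (integrable_expMode_mul hf _) (integrable_expMode_mul hg _)

theorem coeff_smul (c : ℂ) (f : Torus d → ℂ) (k : Fin d → ℤ) :
    coeff (c • f) k = c * coeff f k := by
  simp only [coeff, Pi.smul_apply, smul_eq_mul, ← integral_const_mul]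
  congr 1
  ext x
  ring

theorem coeff_conj (f : Torus d → ℂ) (k : Fin d → ℤ) :
    coeff (fun x => (starRingEnd ℂ) (f x)) k = (starRingEnd ℂ) (coeff f (-k)) := by
  simp only [coeff, ← integral_conj, map_mul, expMode_neg, Complex.conj_conj]

theorem _root_.Continuous.integrable_torus {f : Torus d → ℂ} (hf : Continuous f) :
    Integrable f (torusMeasure d) :=
  hf.integrable_of_hasCompactSupport (HasCompactSupport.of_compactSpace f)

theorem _root_.Continuous.memLp_torus {f : Torus d → ℂ} (hf : Continuous f) (p : ENNReal) :
    MemLp f p (torusMeasure d) :=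
  hf.memLp_of_hasCompactSupport (HasCompactSupport.of_compactSpace f)

/-- Uniform density of trigonometric polynomials passes to `L²`, and an `L²` function orthogonal to
a dense subspace vanishes. -/
theorem ae_eq_zero_of_coeff_eq_zero {f : Torus d → ℂ} (hf : MemLp f 2 (torusMeasure d))
    (h : ∀ k, coeff f k = 0) : f =ᵐ[torusMeasure d] 0 := by
  have hdense : (Submodule.span ℂ (Set.range fun k : Fin d → ℤ =>
      ContinuousMap.toLp (E := ℂ) 2 (torusMeasure d) ℂ (expModeC k))).topologicalClosure = ⊤ := by
    simpa only [Submodule.map_span, ContinuousLinearMap.coe_coe, ← Set.range_comp,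
      Function.comp_def] using
      (ContinuousMap.toLp_denseRange ℂ (torusMeasure d) ℂ
        (p := 2) (by simp)).topologicalClosure_map_submodule span_expModeC_closure_eq_top
  rw [Submodule.topologicalClosure_eq_top_iff] at hdense
  have hmem : hf.toLp f ∈ (Submodule.span ℂ (Set.range fun k : Fin d → ℤ =>
      ContinuousMap.toLp (E := ℂ) 2 (torusMeasure d) ℂ (expModeC k)))ᗮ := by
    rw [Submodule.mem_orthogonal]
    intro u hu
    induction hu using Submodule.span_induction with
    | mem u hu =>
      obtain ⟨k, rfl⟩ := hu
      rw [← h k, MeasureTheory.L2.inner_def]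
      refine integral_congr_ae ?_
      filter_upwards [hf.coeFn_toLp, ContinuousMap.coeFn_toLp (torusMeasure d) (𝕜 := ℂ) (p := 2)
        (expModeC k)] with x hx hx'
      rw [hx, hx']
      simp [expModeC, expMode_neg, mul_comm]
    | zero => simp
    | add x y _ _ hx hy => rw [inner_add_left, hx, hy, add_zero]
    | smul c x _ hx => rw [inner_smul_left, hx, mul_zero]
  rw [hdense, Submodule.mem_bot] at hmem
  exact (hf.coeFn_toLp).symm.trans (hmem ▸ Lp.coeFn_zero _ _ _)

/-! ### Absolutely convergent Fourier series -/

/-- The trigonometric series with coefficients `a`. -/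
def synth (a : (Fin d → ℤ) → ℂ) (x : Torus d) : ℂ := ∑' k, a k * expMode k x

theorem continuous_synth {a : (Fin d → ℤ) → ℂ} (ha : Summable fun k => ‖a k‖) :
    Continuous (synth a) :=
  continuous_tsum (fun k => continuous_const.mul (continuous_expMode k)) ha
    fun k x => by rw [norm_mul, norm_expMode, mul_one]

/-- Termwise integration. Absolute convergence is needed for one factor only; `g = 1` gives the
coefficients of a series, general `g` the convolution formula for products. -/
theorem coeff_synth_mul {a : (Fin d → ℤ) → ℂ} (ha : Summable fun k => ‖a k‖) {g : Torus d → ℂ}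
    (hg : Integrable g (torusMeasure d)) (k : Fin d → ℤ) :
    HasSum (fun l => a l * coeff g (k - l)) (coeff (fun x => synth a x * g x) k) := by
  have h := hasSum_integral_of_summable_integral_norm (μ := torusMeasure d)
    (F := fun l x => a l * (expMode (-(k - l)) x * g x))
    (fun l => (integrable_expMode_mul hg _).const_mul _) ?_
  · simp only [integral_const_mul] at h
    refine Eq.subst (motive := fun z => HasSum _ z) ?_ h
    refine integral_congr_ae (ae_of_all _ fun x => ?_)
    simp only
    rw [synth, ← mul_assoc, mul_comm (expMode (-k) x), mul_assoc, ← tsum_mul_right]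
    refine tsum_congr fun l => ?_
    rw [neg_sub, sub_eq_add_neg, expMode_add]
    ring
  · simp only [norm_mul, norm_expMode, one_mul, integral_const_mul]
    exact ha.mul_right _

theorem coeff_one (k : Fin d → ℤ) : coeff (fun _ : Torus d => (1 : ℂ)) k = if k = 0 then 1 else 0 := by
  simp only [coeff, mul_one, integral_expMode, neg_eq_zero]

theorem coeff_synth {a : (Fin d → ℤ) → ℂ} (ha : Summable fun k => ‖a k‖) (k : Fin d → ℤ) :
    coeff (synth a) k = a k := by
  have h := coeff_synth_mul ha (integrable_const (1 : ℂ)) k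
  simp only [mul_one, coeff_one] at h
  refine h.unique ?_
  convert hasSum_ite_eq k (a k) using 2 with l
  by_cases hl : l = k
  · simp [hl]
  · simp [hl, sub_eq_zero, Ne.symm hl]

theorem synth_coeff_ae_eq {f : Torus d → ℂ} (hf : MemLp f 2 (torusMeasure d))
    (ha : Summable fun k => ‖coeff f k‖) : synth (coeff f) =ᵐ[torusMeasure d] f := by
  have h := ae_eq_zero_of_coeff_eq_zero (((continuous_synth ha).memLp_torus 2).sub hf) fun k => by
    rw [coeff_sub (continuous_synth ha).integrable_torus (hf.integrable one_le_two),
      coeff_synth ha, sub_self]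
  filter_upwards [h] with x hx
  exact sub_eq_zero.mp hx

instance isOpenPosMeasure_torusMeasure (d : ℕ) : (torusMeasure d).IsOpenPosMeasure :=
  inferInstanceAs (Measure.IsOpenPosMeasure (Measure.pi fun _ => AddCircle.haarAddCircle))

theorem synth_coeff {f : Torus d → ℂ} (hf : Continuous f)
    (ha : Summable fun k => ‖coeff f k‖) : synth (coeff f) = f :=
  (continuous_synth ha).ae_eq_iff_eq _ hf |>.mp (synth_coeff_ae_eq (hf.memLp_torus 2) ha)

/-! ### Weights -/

/-- The weight `(1 + |k|)^s`. -/
def wt (s : ℝ) (k : Fin d → ℤ) : ℝ := (1 + Real.sqrt (modeSq k)) ^ s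

theorem modeSq_nonneg (k : Fin d → ℤ) : 0 ≤ modeSq k :=
  Finset.sum_nonneg fun _ _ => sq_nonneg _

theorem one_le_bracket (k : Fin d → ℤ) : 1 ≤ 1 + Real.sqrt (modeSq k) :=
  le_add_of_nonneg_right (Real.sqrt_nonneg _)

theorem bracket_pos (k : Fin d → ℤ) : 0 < 1 + Real.sqrt (modeSq k) :=
  zero_lt_one.trans_le (one_le_bracket k)

theorem wt_pos (s : ℝ) (k : Fin d → ℤ) : 0 < wt s k := Real.rpow_pos_of_pos (bracket_pos k) s

theorem wt_add (s t : ℝ) (k : Fin d → ℤ) : wt (s + t) k = wt s k * wt t k :=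
  Real.rpow_add (bracket_pos k) s t

theorem wt_neg (s : ℝ) (k : Fin d → ℤ) : wt (-s) k = (wt s k)⁻¹ :=
  Real.rpow_neg (bracket_pos k).le s

theorem one_le_wt {s : ℝ} (hs : 0 ≤ s) (k : Fin d → ℤ) : 1 ≤ wt s k :=
  Real.one_le_rpow (one_le_bracket k) hs

theorem wt_mono {s t : ℝ} (h : s ≤ t) (k : Fin d → ℤ) : wt s k ≤ wt t k :=
  Real.rpow_le_rpow_of_exponent_le (one_le_bracket k) h

theorem sobolevWeight_eq (s : ℝ) (k : Fin d → ℤ) : sobolevWeight s k = wt s k ^ 2 := by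
  rw [sobolevWeight, wt, mul_comm, Real.rpow_mul (bracket_pos k).le, Real.rpow_two]

/-- A frequency as a vector of Euclidean space. -/
def freqVec (k : Fin d → ℤ) : EuclideanSpace ℝ (Fin d) := WithLp.toLp 2 fun j => (k j : ℝ)

theorem norm_freqVec (k : Fin d → ℤ) : ‖freqVec k‖ = Real.sqrt (modeSq k) := by
  simp [EuclideanSpace.norm_eq, freqVec, modeSq]

theorem freqVec_add (k l : Fin d → ℤ) : freqVec (k + l) = freqVec k + freqVec l := by
  ext j
  simp [freqVec]

theorem modeSq_eq (k : Fin d → ℤ) : modeSq k = ‖freqVec k‖ ^ 2 := by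
  rw [norm_freqVec, Real.sq_sqrt (modeSq_nonneg k)]

theorem modeSq_neg (k : Fin d → ℤ) : modeSq (-k) = modeSq k := by
  simp [modeSq]

theorem wt_neg_freq (s : ℝ) (k : Fin d → ℤ) : wt s (-k) = wt s k := by
  simp [wt, modeSq_neg]

/-- The left side is `2|k·l|`: the resonance costs one derivative on each factor and never two on
the same one. -/
theorem abs_modeSq_add_sub_sub_le (k l : Fin d → ℤ) :
    |modeSq (k + l) - modeSq k - modeSq l| ≤ 2 * (wt 1 k * wt 1 l) := by
  have h : modeSq (k + l) - modeSq k - modeSq l = 2 * inner ℝ (freqVec k) (freqVec l) := by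
    rw [modeSq_eq, modeSq_eq, modeSq_eq, freqVec_add, norm_add_sq_real]
    ring
  rw [h, abs_mul, abs_two]
  have h1 := abs_real_inner_le_norm (freqVec k) (freqVec l)
  have h2 : ‖freqVec k‖ * ‖freqVec l‖ ≤ wt 1 k * wt 1 l := by
    simp only [wt, Real.rpow_one, norm_freqVec]
    gcongr <;> linarith
  linarith

/-- One of `l` and `k - l` carries at least half of the bracket of `k`. -/
theorem wt_le {s : ℝ} (hs : 0 ≤ s) (k l : Fin d → ℤ) :
    wt s k ≤ 2 ^ s * (wt s l + wt s (k - l)) := by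
  have h : 1 + Real.sqrt (modeSq k) ≤
      2 * max (1 + Real.sqrt (modeSq l)) (1 + Real.sqrt (modeSq (k - l))) := by
    have h1 : Real.sqrt (modeSq k) ≤ Real.sqrt (modeSq l) + Real.sqrt (modeSq (k - l)) := by
      rw [← norm_freqVec, ← norm_freqVec, ← norm_freqVec]
      calc ‖freqVec k‖ = ‖freqVec l + freqVec (k - l)‖ := by rw [← freqVec_add]; congr 2; abel
        _ ≤ _ := norm_add_le _ _
    have h2 := le_max_left (1 + Real.sqrt (modeSq l)) (1 + Real.sqrt (modeSq (k - l)))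
    have h3 := le_max_right (1 + Real.sqrt (modeSq l)) (1 + Real.sqrt (modeSq (k - l)))
    linarith
  have h4 : wt s k ≤ 2 ^ s * (max (1 + Real.sqrt (modeSq l)) (1 + Real.sqrt (modeSq (k - l)))) ^ s := by
    rw [← Real.mul_rpow two_pos.le ((bracket_pos l).le.trans (le_max_left _ _))]
    exact Real.rpow_le_rpow (bracket_pos k).le h hs
  refine h4.trans ?_
  gcongr
  rcases max_cases (1 + Real.sqrt (modeSq l)) (1 + Real.sqrt (modeSq (k - l))) with ⟨h, -⟩ | ⟨h, -⟩ <;>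
    rw [h]
  · exact le_add_of_nonneg_right (wt_pos s _).le
  · exact le_add_of_nonneg_left (wt_pos s _).le

/-- Comparison with `∑ |k|^{-2s}` over the lattice `ℤ^d` in Euclidean space, which converges exactly
because `2s > d`. -/
theorem summable_wt_neg_sq {s : ℝ} (hs : (d : ℝ) / 2 < s) :
    Summable fun k : Fin d → ℤ => wt (-s) k ^ 2 := by
  let b := (EuclideanSpace.basisFun (Fin d) ℝ).toBasis
  let L : Submodule ℤ (EuclideanSpace ℝ (Fin d)) := Submodule.span ℤ (Set.range b)
  have hmem : ∀ k : Fin d → ℤ, freqVec k ∈ L := by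
    intro k
    have : freqVec k = ∑ j, k j • b j := by
      ext i
      simp [freqVec, b, Finset.sum_apply, Pi.single_apply]
    rw [this]
    exact Submodule.sum_mem _ fun j _ => Submodule.smul_mem _ _ (Submodule.subset_span ⟨j, rfl⟩)
  have hrank : Module.finrank ℤ L = d := by
    rw [ZLattice.rank ℝ L]
    simp
  have h1 := ZLattice.summable_norm_rpow L (-(2 * s)) (by rw [hrank]; linarith)
  have hinj : Function.Injective fun k : Fin d → ℤ => (⟨freqVec k, hmem k⟩ : L) := by
    intro k l hkl
    funext j
    have := congrArg (fun v : L => (v : EuclideanSpace ℝ (Fin d)) j) hkl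
    simpa [freqVec] using this
  have h2 := h1.comp_injective hinj
  refine Summable.of_norm_bounded_eventually h2 ?_
  -- The comparison fails only at `k = 0`, where the real power of `0` evaluates to `0` while the
  -- weight is `1`.
  filter_upwards [(Set.finite_singleton (0 : Fin d → ℤ)).compl_mem_cofinite] with k hk
  have hk' : 0 < Real.sqrt (modeSq k) := by
    rw [← norm_freqVec, norm_pos_iff]
    contrapose! hk
    have : k = 0 := by
      funext j
      have := congrArg (fun v : EuclideanSpace ℝ (Fin d) => v j) hk
      simpa [freqVec] using this
    simp [this]
  rw [← sobolevWeight_eq, sobolevWeight, Real.norm_of_nonneg (Real.rpow_nonneg (bracket_pos k).le _)]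
  simp only [Function.comp_apply, Submodule.coe_norm, norm_freqVec]
  rw [show 2 * -s = -(2 * s) by ring]
  have hd : (0 : ℝ) ≤ d := Nat.cast_nonneg d
  exact Real.rpow_le_rpow_of_nonpos hk' (by linarith) (by linarith)

/-! ### Convolution inequalities -/

/-- Hölder's inequality for the counting measure. Extended nonnegative values free the convolution
estimates from all summability conditions. -/
theorem ennreal_tsum_mul_sq_le {ι : Type*} (f g : ι → ENNReal) :
    (∑' i, f i * g i) ^ 2 ≤ (∑' i, f i ^ 2) * ∑' i, g i ^ 2 := by
  let _ : MeasurableSpace ι := ⊤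
  have h := ENNReal.lintegral_mul_le_Lp_mul_Lq (Measure.count (α := ι)) Real.HolderConjugate.two_two
    (f := f) (g := g) (measurable_from_top.aemeasurable) (measurable_from_top.aemeasurable)
  simp only [lintegral_count, Pi.mul_apply, ENNReal.rpow_two] at h
  refine (pow_le_pow_left' h 2).trans_eq ?_
  rw [mul_pow, ← ENNReal.rpow_two, ← ENNReal.rpow_two, ← ENNReal.rpow_mul, ← ENNReal.rpow_mul]
  norm_num

/-- Split `a = a^{1/2} a^{1/2}`, apply Cauchy–Schwarz with weight `a`, then exchange the sums. -/
theorem ennreal_young {G : Type*} [AddCommGroup G] (a b : G → ENNReal) :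
    ∑' k, (∑' l, a l * b (k - l)) ^ 2 ≤ (∑' l, a l) ^ 2 * ∑' k, b k ^ 2 := by
  have h : ∀ k, (∑' l, a l * b (k - l)) ^ 2 ≤ (∑' l, a l) * ∑' l, a l * b (k - l) ^ 2 := by
    intro k
    have hs : ∀ x : ENNReal, x ^ (1 / 2 : ℝ) * x ^ (1 / 2 : ℝ) = x := fun x => by
      rw [← ENNReal.rpow_add_of_nonneg _ _ (by norm_num) (by norm_num)]
      norm_num
    have h1 := ennreal_tsum_mul_sq_le (fun l => a l ^ (1 / 2 : ℝ))
      (fun l => a l ^ (1 / 2 : ℝ) * b (k - l))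
    simp only [← mul_assoc, hs, mul_pow] at h1
    simpa only [sq (_ ^ (1 / 2 : ℝ)), hs] using h1
  refine (ENNReal.tsum_le_tsum h).trans_eq ?_
  rw [ENNReal.tsum_mul_left, ENNReal.tsum_comm, sq, mul_assoc]
  congr 1
  simp_rw [ENNReal.tsum_mul_left]
  rw [← ENNReal.tsum_mul_right]
  refine tsum_congr fun l => ?_
  congr 1
  exact (Equiv.subRight l).tsum_eq fun k => b k ^ 2

theorem ennreal_add_sq_le (x y : ENNReal) : (x + y) ^ 2 ≤ 2 * (x ^ 2 + y ^ 2) := by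
  have := ENNReal.rpow_add_le_mul_rpow_add_rpow x y (p := 2) (by norm_num)
  simp only [ENNReal.rpow_two] at this
  norm_num at this
  exact this

/-- The weight goes to the factor of higher frequency, measured in `ℓ²`; the other is measured in
`ℓ¹`, which the weighted `ℓ²` norm controls through Cauchy–Schwarz against `wt (-s)`. The `4` is `2`
from squaring a sum times two symmetric terms. -/
theorem ennreal_conv_le {s : ℝ} (hs : 0 ≤ s) (a b : (Fin d → ℤ) → ENNReal) :
    ∑' k, (ENNReal.ofReal (wt s k) * ∑' l, a l * b (k - l)) ^ 2 ≤
      4 * ENNReal.ofReal (2 ^ s) ^ 2 * (∑' k : Fin d → ℤ, ENNReal.ofReal (wt (-s) k) ^ 2) *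
        ((∑' k, (ENNReal.ofReal (wt s k) * a k) ^ 2) *
          ∑' k, (ENNReal.ofReal (wt s k) * b k) ^ 2) := by
  set v : (Fin d → ℤ) → ENNReal := fun k => ENNReal.ofReal (wt s k) with hv
  set C := ENNReal.ofReal (2 ^ s)
  set K := ∑' k : Fin d → ℤ, ENNReal.ofReal (wt (-s) k) ^ 2
  have hl1 : ∀ a : (Fin d → ℤ) → ENNReal, (∑' k, a k) ^ 2 ≤ K * ∑' k, (v k * a k) ^ 2 := by
    intro a
    refine le_trans (le_of_eq ?_) (ennreal_tsum_mul_sq_le _ _)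
    congr 1
    refine tsum_congr fun k => ?_
    rw [← mul_assoc, hv, ← ENNReal.ofReal_mul (wt_pos _ _).le, wt_neg,
      inv_mul_cancel₀ (wt_pos _ _).ne', ENNReal.ofReal_one, one_mul]
  have hvk : ∀ k l, v k ≤ C * (v l + v (k - l)) := by
    intro k l
    rw [hv, ← ENNReal.ofReal_add (wt_pos _ _).le (wt_pos _ _).le, ← ENNReal.ofReal_mul (by positivity)]
    exact ENNReal.ofReal_le_ofReal (wt_le hs k l)
  have h1 : ∀ k, (v k * ∑' l, a l * b (k - l)) ^ 2 ≤
      C ^ 2 * (2 * ((∑' l, b l * (v (k - l) * a (k - l))) ^ 2 +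
        (∑' l, a l * (v (k - l) * b (k - l))) ^ 2)) := by
    intro k
    refine le_trans ?_ (mul_le_mul_right (ennreal_add_sq_le _ _) _)
    rw [← mul_pow]
    refine pow_le_pow_left' ?_ 2
    have h2 : ∑' l, b l * (v (k - l) * a (k - l)) = ∑' l, b (k - l) * (v l * a l) := by
      rw [← (Equiv.subLeft k).tsum_eq]
      simp
    rw [h2, ← ENNReal.tsum_mul_left, ← ENNReal.tsum_add, ← ENNReal.tsum_mul_left]
    refine ENNReal.tsum_le_tsum fun l => ?_
    calc v k * (a l * b (k - l)) ≤ C * (v l + v (k - l)) * (a l * b (k - l)) := by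
          gcongr; exact hvk k l
      _ = _ := by ring
  refine (ENNReal.tsum_le_tsum h1).trans ?_
  rw [ENNReal.tsum_mul_left, ENNReal.tsum_mul_left, ENNReal.tsum_add]
  have h3 := ennreal_young b (fun k => v k * a k)
  have h4 := ennreal_young a (fun k => v k * b k)
  calc _ ≤ C ^ 2 * (2 * (K * (∑' k, (v k * b k) ^ 2) * (∑' k, (v k * a k) ^ 2) +
        K * (∑' k, (v k * a k) ^ 2) * (∑' k, (v k * b k) ^ 2))) := by
        gcongr
        · exact h3.trans (mul_le_mul_left (hl1 b) _)
        · exact h4.trans (mul_le_mul_left (hl1 a) _)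
    _ = _ := by ring

/-! ### Weighted square-summable sequences -/

/-- The weighted `ℓ²` norm of the sequence `a` is at most `A`. -/
structure SeqBound (s A : ℝ) (a : (Fin d → ℤ) → ℝ) : Prop where
  nonneg : 0 ≤ A
  sum_le : ∀ F : Finset (Fin d → ℤ), ∑ k ∈ F, (wt s k * a k) ^ 2 ≤ A ^ 2

namespace SeqBound

variable {s A B : ℝ} {a b c : (Fin d → ℤ) → ℝ}

theorem of_abs_le (h : SeqBound s A a) (hle : ∀ k, |b k| ≤ |a k|) : SeqBound s A b := by
  refine ⟨h.nonneg, fun F => (Finset.sum_le_sum fun k _ => ?_).trans (h.sum_le F)⟩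
  rw [mul_pow, mul_pow]
  exact mul_le_mul_of_nonneg_left (sq_le_sq.mpr (hle k)) (sq_nonneg _)

theorem mono (h : SeqBound s A a) (hAB : A ≤ B) : SeqBound s B a :=
  ⟨h.nonneg.trans hAB, fun F => (h.sum_le F).trans (pow_le_pow_left₀ h.nonneg hAB 2)⟩

theorem add (ha : SeqBound s A a) (hb : SeqBound s B b) :
    SeqBound s (A + B) (fun k => a k + b k) := by
  refine ⟨add_nonneg ha.nonneg hb.nonneg, fun F => ?_⟩
  have h1 := Finset.sum_mul_sq_le_sq_mul_sq F (fun k => wt s k * a k) (fun k => wt s k * b k)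
  have h2 : ∑ k ∈ F, wt s k * a k * (wt s k * b k) ≤ A * B := by
    refine abs_le_of_sq_le_sq' ?_ (mul_nonneg ha.nonneg hb.nonneg) |>.2
    rw [mul_pow]
    exact h1.trans (mul_le_mul (ha.sum_le F) (hb.sum_le F)
      (Finset.sum_nonneg fun _ _ => sq_nonneg _) (sq_nonneg _))
  have h3 : ∑ k ∈ F, (wt s k * (a k + b k)) ^ 2 = ∑ k ∈ F, (wt s k * a k) ^ 2 +
      2 * ∑ k ∈ F, wt s k * a k * (wt s k * b k) + ∑ k ∈ F, (wt s k * b k) ^ 2 := by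
    rw [Finset.mul_sum, ← Finset.sum_add_distrib, ← Finset.sum_add_distrib]
    exact Finset.sum_congr rfl fun k _ => by ring
  rw [h3]
  nlinarith [ha.sum_le F, hb.sum_le F]

theorem const_mul (ha : SeqBound s A a) {x : ℝ} (hx : 0 ≤ x) :
    SeqBound s (x * A) (fun k => x * a k) := by
  refine ⟨mul_nonneg hx ha.nonneg, fun F => ?_⟩
  have : ∑ k ∈ F, (wt s k * (x * a k)) ^ 2 = x ^ 2 * ∑ k ∈ F, (wt s k * a k) ^ 2 := by
    rw [Finset.mul_sum]
    exact Finset.sum_congr rfl fun k _ => by ring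
  rw [this, mul_pow]
  exact mul_le_mul_of_nonneg_left (ha.sum_le F) (sq_nonneg _)

theorem of_le {t : ℝ} (ha : SeqBound t A a) (hst : s ≤ t) : SeqBound s A a := by
  refine ⟨ha.nonneg, fun F => (Finset.sum_le_sum fun k _ => ?_).trans (ha.sum_le F)⟩
  rw [mul_pow, mul_pow]
  exact mul_le_mul_of_nonneg_right (pow_le_pow_left₀ (wt_pos _ _).le (wt_mono hst k) 2) (sq_nonneg _)

theorem abs_le (ha : SeqBound s A a) (hs : 0 ≤ s) (k : Fin d → ℤ) : |a k| ≤ A := by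
  have h := ha.sum_le {k}
  rw [Finset.sum_singleton] at h
  have h1 := abs_le_of_sq_le_sq h ha.nonneg
  rw [abs_mul, abs_of_pos (wt_pos s k)] at h1
  nlinarith [one_le_wt hs k, abs_nonneg (a k)]

theorem shift_weight {γ : ℝ} (ha : SeqBound (s + γ) A a) : SeqBound s A (fun k => wt γ k * a k) := by
  refine ⟨ha.nonneg, fun F => le_of_eq_of_le (Finset.sum_congr rfl fun k _ => ?_) (ha.sum_le F)⟩
  rw [wt_add, mul_assoc]

theorem neg_freq (ha : SeqBound s A a) : SeqBound s A (fun k => a (-k)) := by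
  refine ⟨ha.nonneg, fun F => ?_⟩
  have h := ha.sum_le (F.map (Equiv.neg _).toEmbedding)
  rw [Finset.sum_map] at h
  simpa [wt_neg_freq] using h

theorem summable (ha : SeqBound s A a) (hs : (d : ℝ) / 2 < s) : Summable fun k => |a k| := by
  have h1 : Summable fun k => (wt s k * a k) ^ 2 :=
    summable_of_sum_le (fun _ => sq_nonneg _) ha.sum_le
  refine Summable.of_nonneg_of_le (fun _ => abs_nonneg _) (fun k => ?_)
    ((summable_wt_neg_sq hs).add h1)
  -- A product of two square-summable factors, so it is dominated by the sum of their squares.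
  have h2 : wt (-s) k * (wt s k * |a k|) = |a k| := by
    rw [← mul_assoc, wt_neg, inv_mul_cancel₀ (wt_pos _ _).ne', one_mul]
  have h3 : (wt s k * a k) ^ 2 = (wt s k * |a k|) ^ 2 := by rw [mul_pow, mul_pow, sq_abs]
  rw [h3]
  nlinarith [sq_nonneg (wt (-s) k - wt s k * |a k|), sq_nonneg (wt (-s) k + wt s k * |a k|)]

theorem tsum_le (ha : SeqBound s A a) :
    ∑' k, (ENNReal.ofReal (wt s k) * ENNReal.ofReal |a k|) ^ 2 ≤ ENNReal.ofReal (A ^ 2) := by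
  rw [ENNReal.tsum_eq_iSup_sum]
  refine iSup_le fun F => ?_
  have h : ∀ k, (ENNReal.ofReal (wt s k) * ENNReal.ofReal |a k|) ^ 2 =
      ENNReal.ofReal ((wt s k * a k) ^ 2) := fun k => by
    rw [← ENNReal.ofReal_mul (wt_pos _ _).le, ← ENNReal.ofReal_pow (by
      have := wt_pos s k; positivity), mul_pow, mul_pow, sq_abs]
  simp_rw [h]
  rw [← ENNReal.ofReal_sum_of_nonneg fun _ _ => sq_nonneg _]
  exact ENNReal.ofReal_le_ofReal (ha.sum_le F)

theorem of_tsum_le (hA : 0 ≤ A)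
    (h : ∑' k, (ENNReal.ofReal (wt s k) * ENNReal.ofReal |a k|) ^ 2 ≤ ENNReal.ofReal (A ^ 2)) :
    SeqBound s A a := by
  refine ⟨hA, fun F => ?_⟩
  have h1 := (ENNReal.sum_le_tsum F).trans h
  have h : ∀ k, (ENNReal.ofReal (wt s k) * ENNReal.ofReal |a k|) ^ 2 =
      ENNReal.ofReal ((wt s k * a k) ^ 2) := fun k => by
    rw [← ENNReal.ofReal_mul (wt_pos _ _).le, ← ENNReal.ofReal_pow (by
      have := wt_pos s k; positivity), mul_pow, mul_pow, sq_abs]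
  simp_rw [h] at h1
  rw [← ENNReal.ofReal_sum_of_nonneg fun _ _ => sq_nonneg _] at h1
  exact (ENNReal.ofReal_le_ofReal_iff (sq_nonneg _)).mp h1

theorem summable_conv (ha : SeqBound s A a) (hb : SeqBound s B b) (hs : (d : ℝ) / 2 < s)
    (k : Fin d → ℤ) : Summable fun l => |a l| * |b (k - l)| := by
  have hd : (0 : ℝ) ≤ d := Nat.cast_nonneg d
  exact Summable.of_nonneg_of_le (fun _ => by positivity)
    (fun l => mul_le_mul_of_nonneg_left (hb.abs_le (by linarith) _) (abs_nonneg _))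
    ((ha.summable hs).mul_right B)

/-- The constant of the algebra property of `H^s`. -/
def _root_.NLS.algConst (d : ℕ) (s : ℝ) : ℝ :=
  2 * 2 ^ s * Real.sqrt (∑' k : Fin d → ℤ, wt (-s) k ^ 2)

theorem _root_.NLS.algConst_nonneg (d : ℕ) (s : ℝ) : 0 ≤ algConst d s := by
  unfold algConst
  positivity

/-- Requiring only a bound on `c` by a convolution lets the same lemma serve products and
commutators alike. -/
theorem conv (ha : SeqBound s A a) (hb : SeqBound s B b) (hs : (d : ℝ) / 2 < s)
    (hc : ∀ k, |c k| ≤ ∑' l, |a l| * |b (k - l)|) : SeqBound s (algConst d s * (A * B)) c := by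
  have hd : (0 : ℝ) ≤ d := Nat.cast_nonneg d
  have hA := ha.nonneg
  have hB := hb.nonneg
  refine of_tsum_le (mul_nonneg (algConst_nonneg d s) (mul_nonneg hA hB)) ?_
  have h1 : ∀ k, ENNReal.ofReal |c k| ≤
      ∑' l, ENNReal.ofReal |a l| * ENNReal.ofReal |b (k - l)| := by
    intro k
    refine (ENNReal.ofReal_le_ofReal (hc k)).trans_eq ?_
    rw [ENNReal.ofReal_tsum_of_nonneg (fun _ => by positivity) (ha.summable_conv hb hs k)]
    exact tsum_congr fun l => ENNReal.ofReal_mul (abs_nonneg _)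
  calc _ ≤ ∑' k, (ENNReal.ofReal (wt s k) *
        ∑' l, ENNReal.ofReal |a l| * ENNReal.ofReal |b (k - l)|) ^ 2 :=
        ENNReal.tsum_le_tsum fun k => by gcongr; exact h1 k
    _ ≤ _ := ennreal_conv_le (s := s) (by linarith) (fun l => ENNReal.ofReal |a l|)
        (fun l => ENNReal.ofReal |b l|)
    _ ≤ 4 * ENNReal.ofReal (2 ^ s) ^ 2 * (∑' k : Fin d → ℤ, ENNReal.ofReal (wt (-s) k) ^ 2) *
        (ENNReal.ofReal (A ^ 2) * ENNReal.ofReal (B ^ 2)) := by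
        gcongr
        · exact ha.tsum_le
        · exact hb.tsum_le
    _ = _ := by
        have h2 : ∑' k : Fin d → ℤ, ENNReal.ofReal (wt (-s) k) ^ 2 =
            ENNReal.ofReal (∑' k : Fin d → ℤ, wt (-s) k ^ 2) := by
          rw [ENNReal.ofReal_tsum_of_nonneg (fun _ => sq_nonneg _) (summable_wt_neg_sq hs)]
          exact tsum_congr fun k => (ENNReal.ofReal_pow (wt_pos _ _).le 2).symm
        have h3 : (0 : ℝ) ≤ ∑' k : Fin d → ℤ, wt (-s) k ^ 2 := tsum_nonneg fun _ => sq_nonneg _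
        rw [h2, show (4 : ENNReal) = ENNReal.ofReal 4 by simp,
          ← ENNReal.ofReal_pow (by positivity), ← ENNReal.ofReal_mul (by positivity),
          ← ENNReal.ofReal_mul (by positivity), ← ENNReal.ofReal_mul (by positivity),
          ← ENNReal.ofReal_mul (by positivity)]
        congr 1
        rw [algConst, mul_pow, mul_pow, Real.sq_sqrt h3]
        ring

/-- Minkowski's inequality by duality: with `X` the squared norm on `S`, one factor of the square
goes under the integral, and Cauchy–Schwarz at each `σ` yields `X ≤ √X · τA`. No vector-valued
integral is needed. -/
theorem intervalIntegral {τ : ℝ} (hτ : 0 ≤ τ) (hA : 0 ≤ A) {F : (Fin d → ℤ) → ℝ → ℂ}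
    (hF : ∀ k, IntervalIntegrable (F k) volume 0 τ)
    (h : ∀ σ ∈ Set.Icc 0 τ, SeqBound s A fun k => ‖F k σ‖) :
    SeqBound s (τ * A) fun k => ‖∫ σ in (0 : ℝ)..τ, F k σ‖ := by
  refine ⟨mul_nonneg hτ hA, fun S => ?_⟩
  set x : (Fin d → ℤ) → ℝ := fun k => ‖∫ σ in (0 : ℝ)..τ, F k σ‖
  set X := ∑ k ∈ S, (wt s k * x k) ^ 2
  have hX : 0 ≤ X := Finset.sum_nonneg fun _ _ => sq_nonneg _
  have h1 : X ≤ ∫ σ in (0 : ℝ)..τ, ∑ k ∈ S, wt s k * x k * (wt s k * ‖F k σ‖) := by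
    rw [intervalIntegral.integral_finsetSum
      fun k _ => ((hF k).norm.const_mul _).const_mul _]
    refine Finset.sum_le_sum fun k _ => ?_
    rw [intervalIntegral.integral_const_mul, intervalIntegral.integral_const_mul, sq]
    have hw := wt_pos s k
    gcongr
    exact intervalIntegral.norm_integral_le_integral_norm hτ
  have h2 : ∫ σ in (0 : ℝ)..τ, ∑ k ∈ S, wt s k * x k * (wt s k * ‖F k σ‖) ≤
      ∫ _ in (0 : ℝ)..τ, Real.sqrt X * A := by
    refine intervalIntegral.integral_mono_on hτ
      (by simpa only [Finset.sum_fn] using IntervalIntegrable.sum S fun k _ =>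
        ((hF k).norm.const_mul (wt s k)).const_mul (wt s k * x k))
      intervalIntegrable_const fun σ hσ => ?_
    refine (Real.sum_mul_le_sqrt_mul_sqrt S (fun k => wt s k * x k) _).trans ?_
    gcongr
    exact Real.sqrt_le_iff.mpr ⟨hA, (h σ hσ).sum_le S⟩
  rw [intervalIntegral.integral_const, sub_zero, smul_eq_mul] at h2
  have h3 : Real.sqrt X * Real.sqrt X = X := Real.mul_self_sqrt hX
  have h4 : Real.sqrt X ≤ τ * A := by
    by_contra! hlt
    nlinarith [mul_nonneg hτ hA]
  rw [← h3, ← sq]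
  exact pow_le_pow_left₀ (Real.sqrt_nonneg _) h4 2

end SeqBound

/-! ### Algebra property and Fourier multipliers in `H^s`, `s > d/2` -/

/-- `f` is continuous and its `H^s` norm is at most `A`. -/
structure SobolevBound (s A : ℝ) (f : Torus d → ℂ) : Prop where
  continuous : Continuous f
  seqBound : SeqBound s A fun k => ‖coeff f k‖

/-- The symbol of the multiplier `g(Δ)` is bounded by `1`. -/
def Contractive (d : ℕ) (g : ℂ → ℂ) : Prop := ∀ k : Fin d → ℤ, ‖g (-(modeSq k : ℂ))‖ ≤ 1

theorem laplaceMultiplier_eq_synth (g : ℂ → ℂ) (f : Torus d → ℂ) :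
    laplaceMultiplier g f = synth fun k => g (-(modeSq k : ℂ)) * coeff f k := rfl

namespace SobolevBound

variable {s A B : ℝ} {f h : Torus d → ℂ}

theorem nonneg (hf : SobolevBound s A f) : 0 ≤ A := hf.seqBound.nonneg

theorem integrable (hf : SobolevBound s A f) : Integrable f (torusMeasure d) :=
  hf.continuous.integrable_torus

theorem mono (hf : SobolevBound s A f) (hAB : A ≤ B) : SobolevBound s B f :=
  ⟨hf.continuous, hf.seqBound.mono hAB⟩

theorem of_le {t : ℝ} (hf : SobolevBound t A f) (hst : s ≤ t) : SobolevBound s A f :=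
  ⟨hf.continuous, hf.seqBound.of_le hst⟩

theorem summable (hf : SobolevBound s A f) (hs : (d : ℝ) / 2 < s) :
    Summable fun k => ‖coeff f k‖ := by
  simpa using hf.seqBound.summable hs

theorem synth_eq (hf : SobolevBound s A f) (hs : (d : ℝ) / 2 < s) : synth (coeff f) = f :=
  synth_coeff hf.continuous (hf.summable hs)

/-- Reduces operator identities to identities between scalar symbols. -/
theorem ext_coeff (hf : SobolevBound s A f) (hh : SobolevBound s B h) (hs : (d : ℝ) / 2 < s)
    (hk : ∀ k, coeff f k = coeff h k) : f = h := by
  rw [← hf.synth_eq hs, ← hh.synth_eq hs, funext hk]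

theorem add (hf : SobolevBound s A f) (hh : SobolevBound s B h) :
    SobolevBound s (A + B) (f + h) := by
  refine ⟨hf.continuous.add hh.continuous, (hf.seqBound.add hh.seqBound).of_abs_le fun k => ?_⟩
  rw [coeff_add hf.integrable hh.integrable, abs_norm, abs_of_nonneg (by positivity)]
  exact norm_add_le _ _

theorem sub (hf : SobolevBound s A f) (hh : SobolevBound s B h) :
    SobolevBound s (A + B) (f - h) := by
  refine ⟨hf.continuous.sub hh.continuous, (hf.seqBound.add hh.seqBound).of_abs_le fun k => ?_⟩
  rw [coeff_sub hf.integrable hh.integrable, abs_norm, abs_of_nonneg (by positivity)]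
  exact norm_sub_le _ _

theorem smul (hf : SobolevBound s A f) (c : ℂ) : SobolevBound s (‖c‖ * A) (c • f) := by
  refine ⟨hf.continuous.const_smul c, (hf.seqBound.const_mul (norm_nonneg c)).of_abs_le fun k => ?_⟩
  rw [coeff_smul, norm_mul]

theorem star (hf : SobolevBound s A f) : SobolevBound s A (star f) := by
  refine ⟨hf.continuous.star, hf.seqBound.neg_freq.of_abs_le fun k => ?_⟩
  change |‖coeff (fun x => (starRingEnd ℂ) (f x)) k‖| ≤ _
  rw [coeff_conj, RCLike.norm_conj]

theorem one (s : ℝ) : SobolevBound s 1 (1 : Torus d → ℂ) := by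
  refine ⟨continuous_const, zero_le_one, fun F => ?_⟩
  have h : ∀ k : Fin d → ℤ, (wt s k * ‖coeff (1 : Torus d → ℂ) k‖) ^ 2 = if k = 0 then 1 else 0 := by
    intro k
    change (wt s k * ‖coeff (fun _ => (1 : ℂ)) k‖) ^ 2 = _
    rw [coeff_one]
    split_ifs with hk
    · simp [hk, wt, modeSq]
    · simp
  simp_rw [h, Finset.sum_ite_eq']
  split_ifs <;> norm_num

theorem coeff_mul_hasSum (hf : SobolevBound s A f) (hh : SobolevBound s B h)
    (hs : (d : ℝ) / 2 < s) (k : Fin d → ℤ) :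
    HasSum (fun l => coeff f l * coeff h (k - l)) (coeff (f * h) k) := by
  have := coeff_synth_mul (hf.summable hs) hh.integrable k
  rwa [hf.synth_eq hs] at this

theorem mul (hf : SobolevBound s A f) (hh : SobolevBound s B h) (hs : (d : ℝ) / 2 < s) :
    SobolevBound s (algConst d s * (A * B)) (f * h) := by
  refine ⟨hf.continuous.mul hh.continuous, hf.seqBound.conv hh.seqBound hs fun k => ?_⟩
  have hsum := hf.seqBound.summable_conv hh.seqBound hs k
  simp only [abs_norm] at hsum ⊢
  rw [← (hf.coeff_mul_hasSum hh hs k).tsum_eq]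
  simp only [← norm_mul] at hsum ⊢
  exact norm_tsum_le_tsum_norm hsum

theorem pow (hf : SobolevBound s A f) (hs : (d : ℝ) / 2 < s) (m : ℕ) :
    SobolevBound s ((algConst d s * A) ^ m) (f ^ m) := by
  induction m with
  | zero => simpa using one s
  | succ m ih =>
    rw [pow_succ f]
    exact (ih.mul hf hs).mono (le_of_eq (by ring))

theorem summable_multiplier (hf : SobolevBound s A f) (hs : (d : ℝ) / 2 < s) {g : ℂ → ℂ}
    (hg : Contractive d g) : Summable fun k => ‖g (-(modeSq k : ℂ)) * coeff f k‖ := by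
  refine Summable.of_nonneg_of_le (fun _ => norm_nonneg _) (fun k => ?_) (hf.summable hs)
  rw [norm_mul]
  exact mul_le_of_le_one_left (norm_nonneg _) (hg k)

theorem coeff_multiplier (hf : SobolevBound s A f) (hs : (d : ℝ) / 2 < s) {g : ℂ → ℂ}
    (hg : Contractive d g) (k : Fin d → ℤ) :
    coeff (laplaceMultiplier g f) k = g (-(modeSq k : ℂ)) * coeff f k := by
  rw [laplaceMultiplier_eq_synth, coeff_synth (hf.summable_multiplier hs hg)]

theorem multiplier (hf : SobolevBound s A f) (hs : (d : ℝ) / 2 < s) {g : ℂ → ℂ}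
    (hg : Contractive d g) : SobolevBound s A (laplaceMultiplier g f) := by
  refine ⟨?_, hf.seqBound.of_abs_le fun k => ?_⟩
  · rw [laplaceMultiplier_eq_synth]
    exact continuous_synth (hf.summable_multiplier hs hg)
  · rw [hf.coeff_multiplier hs hg, norm_mul, abs_norm, abs_of_nonneg (by positivity)]
    exact mul_le_of_le_one_left (norm_nonneg _) (hg k)

theorem multiplier_sub (hf : SobolevBound s A f) (hh : SobolevBound s B h) (hs : (d : ℝ) / 2 < s)
    {g : ℂ → ℂ} (hg : Contractive d g) :
    laplaceMultiplier g (f - h) = laplaceMultiplier g f - laplaceMultiplier g h := by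
  have hf' := hf.multiplier hs hg
  have hh' := hh.multiplier hs hg
  refine ((hf.sub hh).multiplier hs hg).ext_coeff (hf'.sub hh') hs fun k => ?_
  rw [(hf.sub hh).coeff_multiplier hs hg, coeff_sub hf.integrable hh.integrable,
    coeff_sub hf'.integrable hh'.integrable, hf.coeff_multiplier hs hg,
    hh.coeff_multiplier hs hg, mul_sub]

end SobolevBound

/-! ### The free group -/

/-- The symbol `e^{-it|k|²}` of `e^{itΔ}`. -/
def phase (t : ℝ) (k : Fin d → ℤ) : ℂ := Complex.exp (Complex.I * ((-(t * modeSq k) : ℝ) : ℂ))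

theorem norm_phase (t : ℝ) (k : Fin d → ℤ) : ‖phase t k‖ = 1 := by
  rw [phase, Complex.norm_exp_I_mul_ofReal]

theorem phase_add (t t' : ℝ) (k : Fin d → ℤ) : phase (t + t') k = phase t k * phase t' k := by
  rw [phase, phase, phase, ← Complex.exp_add]
  congr 1
  push_cast
  ring

theorem phase_zero (k : Fin d → ℤ) : phase 0 k = 1 := by
  simp [phase]

theorem continuous_phase (k : Fin d → ℤ) : Continuous fun t => phase t k := by
  unfold phase
  fun_prop

theorem freeGroup_symbol (t : ℝ) (k : Fin d → ℤ) :
    Complex.exp (Complex.I * t * (-(modeSq k : ℂ))) = phase t k := by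
  rw [phase]
  congr 1
  push_cast
  ring

theorem contractive_freeGroup (t : ℝ) :
    Contractive d fun z => Complex.exp (Complex.I * t * z) := fun k => by
  simp only [freeGroup_symbol, norm_phase, le_refl]

theorem freeGroup_congr_ae {f h : Torus d → ℂ} (H : f =ᵐ[torusMeasure d] h) (t : ℝ) :
    freeGroup t f = freeGroup t h := by
  unfold freeGroup
  rw [laplaceMultiplier_eq_synth, laplaceMultiplier_eq_synth, coeff_congr_ae H]

/-- Interpolates between the bounds `|θ|` and `2`. -/
theorem norm_exp_I_mul_sub_one_le {γ : ℝ} (hγ0 : 0 ≤ γ) (hγ1 : γ ≤ 1) (θ : ℝ) :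
    ‖Complex.exp (Complex.I * θ) - 1‖ ≤ 2 * |θ| ^ γ := by
  rcases le_total |θ| 1 with h | h
  · have h1 := Real.norm_exp_I_mul_ofReal_sub_one_le (x := θ)
    have h2 : |θ| ≤ |θ| ^ γ := by
      rcases (abs_nonneg θ).eq_or_lt with h0 | h0
      · rw [← h0]; positivity
      · simpa using Real.rpow_le_rpow_of_exponent_ge h0 h hγ1
    have h3 : (0 : ℝ) ≤ |θ| ^ γ := by positivity
    rw [Real.norm_eq_abs] at h1
    linarith
  · have h1 : ‖Complex.exp (Complex.I * θ) - 1‖ ≤ 2 := by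
      refine (norm_sub_le _ _).trans ?_
      rw [Complex.norm_exp_I_mul_ofReal]
      norm_num
    have h2 := Real.one_le_rpow h hγ0
    linarith

namespace SobolevBound

variable {s A B : ℝ} {f h : Torus d → ℂ}

theorem coeff_freeGroup (hf : SobolevBound s A f) (hs : (d : ℝ) / 2 < s) (t : ℝ)
    (k : Fin d → ℤ) : coeff (freeGroup t f) k = phase t k * coeff f k := by
  rw [freeGroup, hf.coeff_multiplier hs (contractive_freeGroup t), freeGroup_symbol]

theorem freeGroup (hf : SobolevBound s A f) (hs : (d : ℝ) / 2 < s) (t : ℝ) :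
    SobolevBound s A (freeGroup t f) :=
  hf.multiplier hs (contractive_freeGroup t)

theorem freeGroup_sub (hf : SobolevBound s A f) (hh : SobolevBound s B h) (hs : (d : ℝ) / 2 < s)
    (t : ℝ) : NLS.freeGroup t (f - h) = NLS.freeGroup t f - NLS.freeGroup t h :=
  hf.multiplier_sub hh hs (contractive_freeGroup t)

theorem freeGroup_freeGroup (hf : SobolevBound s A f) (hs : (d : ℝ) / 2 < s) (t t' : ℝ) :
    NLS.freeGroup t (NLS.freeGroup t' f) = NLS.freeGroup (t + t') f := by
  refine ((hf.freeGroup hs t').freeGroup hs t).ext_coeff (hf.freeGroup hs _) hs fun k => ?_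
  rw [(hf.freeGroup hs t').coeff_freeGroup hs, hf.coeff_freeGroup hs, hf.coeff_freeGroup hs,
    phase_add, mul_assoc]

theorem freeGroup_zero (hf : SobolevBound s A f) (hs : (d : ℝ) / 2 < s) :
    NLS.freeGroup 0 f = f := by
  refine (hf.freeGroup hs 0).ext_coeff hf hs fun k => ?_
  rw [hf.coeff_freeGroup hs, phase_zero, one_mul]

/-- Conjugation swaps `k` with `-k` and conjugates the phase; since `|k|²` is even, only the
direction of time changes. -/
theorem star_freeGroup (hf : SobolevBound s A f) (hs : (d : ℝ) / 2 < s) (t : ℝ) :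
    Star.star (NLS.freeGroup t f) = NLS.freeGroup (-t) (Star.star f) := by
  refine (hf.freeGroup hs t).star.ext_coeff (hf.star.freeGroup hs _) hs fun k => ?_
  rw [hf.star.coeff_freeGroup hs]
  change coeff (fun x => (starRingEnd ℂ) (NLS.freeGroup t f x)) k =
    _ * coeff (fun x => (starRingEnd ℂ) (f x)) k
  rw [coeff_conj, coeff_conj, hf.coeff_freeGroup hs, map_mul]
  congr 1
  rw [phase, phase, ← Complex.exp_conj, modeSq_neg, map_mul, Complex.conj_I, Complex.conj_ofReal]
  congr 1
  push_cast
  ring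

/-- The commutator estimate. Each term of the convolution carries `e^{iθ} - 1` with `θ = 2t
l·(k-l)`, and `|θ|^γ` is paid for by the weight `wt γ` on both factors. -/
theorem freeGroup_mul {γ : ℝ} (hs : (d : ℝ) / 2 < s) (hγ0 : 0 ≤ γ) (hγ1 : γ ≤ 1)
    (hf : SobolevBound (s + γ) A f) (hh : SobolevBound (s + γ) B h) (t : ℝ) :
    SobolevBound s (algConst d s * (4 * |t| ^ γ * A * B))
      (NLS.freeGroup t f * NLS.freeGroup t h - NLS.freeGroup t (f * h)) := by
  have hf' := hf.of_le (s := s) (by linarith)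
  have hh' := hh.of_le (s := s) (by linarith)
  have hfh := hf'.mul hh' hs
  have hft := hf'.freeGroup hs t
  have hht := hh'.freeGroup hs t
  have hp := hft.mul hht hs
  have hpt := hfh.freeGroup hs t
  refine ⟨(hp.sub hpt).continuous, ?_⟩
  -- The `4` is `2` from the bound on `e^{iθ} - 1` times `2 ≥ 2^γ`; it is absorbed into the first
  -- sequence.
  have ht : (0 : ℝ) ≤ 4 * |t| ^ γ := by positivity
  refine SeqBound.conv (hf.seqBound.shift_weight.const_mul ht) hh.seqBound.shift_weight hs fun k => ?_
  have hsum := (hf.seqBound.shift_weight.const_mul ht).summable_conv hh.seqBound.shift_weight hs k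
  rw [coeff_sub hp.integrable hpt.integrable, hfh.coeff_freeGroup hs, abs_norm,
    ← ((hft.coeff_mul_hasSum hht hs k).sub
      ((hf'.coeff_mul_hasSum hh' hs k).mul_left (phase t k))).tsum_eq]
  refine tsum_of_norm_bounded hsum.hasSum fun l => ?_
  rw [hf'.coeff_freeGroup hs, hh'.coeff_freeGroup hs]
  set θ : ℝ := t * (modeSq k - modeSq l - modeSq (k - l)) with hθ
  have h1 : phase t l * phase t (k - l) = phase t k * Complex.exp (Complex.I * θ) := by
    rw [phase, phase, phase, ← Complex.exp_add, ← Complex.exp_add]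
    congr 1
    push_cast [hθ]
    ring
  have h2 : phase t l * coeff f l * (phase t (k - l) * coeff h (k - l)) -
      phase t k * (coeff f l * coeff h (k - l)) =
      phase t k * ((Complex.exp (Complex.I * θ) - 1) * (coeff f l * coeff h (k - l))) := by
    linear_combination coeff f l * coeff h (k - l) * h1
  rw [h2, norm_mul, norm_phase, one_mul, norm_mul, norm_mul]
  have hw : ∀ k : Fin d → ℤ, wt 1 k ^ γ = wt γ k := fun k => by
    rw [wt, wt, Real.rpow_one]
  have h3 : |θ| ^ γ ≤ 2 * (|t| ^ γ * (wt γ l * wt γ (k - l))) := by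
    have h4 : |θ| ≤ 2 * (|t| * (wt 1 l * wt 1 (k - l))) := by
      have := abs_modeSq_add_sub_sub_le l (k - l)
      rw [add_sub_cancel] at this
      rw [hθ, abs_mul]
      nlinarith [abs_nonneg t]
    have hl := wt_pos 1 l
    have hl' := wt_pos 1 (k - l)
    refine (Real.rpow_le_rpow (abs_nonneg θ) h4 hγ0).trans ?_
    rw [Real.mul_rpow two_pos.le (by positivity), Real.mul_rpow (abs_nonneg t) (by positivity),
      Real.mul_rpow hl.le hl'.le, hw, hw]
    have hl := wt_pos γ l
    have hl' := wt_pos γ (k - l)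
    gcongr
    simpa using Real.rpow_le_rpow_of_exponent_le one_le_two hγ1
  have h5 := norm_exp_I_mul_sub_one_le hγ0 hγ1 θ
  have hl := wt_pos γ l
  have hl' := wt_pos γ (k - l)
  rw [abs_of_nonneg (a := 4 * |t| ^ γ * (wt γ l * ‖coeff f l‖)) (by positivity),
    abs_of_nonneg (a := wt γ (k - l) * ‖coeff h (k - l)‖) (by positivity)]
  calc _ ≤ 4 * (|t| ^ γ * (wt γ l * wt γ (k - l))) * (‖coeff f l‖ * ‖coeff h (k - l)‖) := by
        gcongr
        linarith
    _ = _ := by ring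

end SobolevBound

/-! ### Boundedness and Lipschitz continuity of the filtered nonlinearity -/

/-- The expression `w^{p+1} (g(Δ) w̄^p)`. -/
def multNonlin (p : ℕ) (g : ℂ → ℂ) (w : Torus d → ℂ) : Torus d → ℂ :=
  w ^ (p + 1) * laplaceMultiplier g (star w ^ p)

/-- The symbol of `e^{itΔ}` as a function of `Δ`. -/
def expSymbol (t : ℝ) (z : ℂ) : ℂ := Complex.exp (Complex.I * t * z)

theorem contractive_expSymbol (t : ℝ) : Contractive d (expSymbol t) := contractive_freeGroup t

/-- At time `0` the symbol is `1`, so the exact nonlinearity belongs to the same family as the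
frozen integrand and the scheme. -/
theorem nonlinearity_eq {s A : ℝ} {f : Torus d → ℂ} (hf : SobolevBound s A f)
    (hs : (d : ℝ) / 2 < s) (p : ℕ) : nonlinearity p f = multNonlin p (expSymbol 0) f := by
  have h := (hf.star.pow hs p).freeGroup_zero hs
  rw [freeGroup] at h
  rw [multNonlin]
  change _ = _ * laplaceMultiplier (fun z => Complex.exp (Complex.I * (0 : ℝ) * z)) _
  rw [h]
  funext x
  simp only [nonlinearity, Pi.mul_apply, Pi.pow_apply, Pi.star_apply]
  rw [pow_succ, mul_right_comm, ← mul_pow, pow_mul]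
  congr 2
  rw [← Complex.mul_conj', starRingEnd_apply]

theorem multNonlin_bound {r : ℝ} (hr : (d : ℝ) / 2 < r) (p : ℕ) (R : ℝ) :
    ∃ K, ∀ g, Contractive d g → ∀ w : Torus d → ℂ, SobolevBound r R w →
      SobolevBound r K (multNonlin p g w) :=
  ⟨_, fun _ hg _ hw => (hw.pow hr (p + 1)).mul ((hw.star.pow hr p).multiplier hr hg) hr⟩

theorem pow_sub_bound {r : ℝ} (hr : (d : ℝ) / 2 < r) (m : ℕ) (R : ℝ) :
    ∃ K, 0 ≤ K ∧ ∀ (w v : Torus d → ℂ) (δ : ℝ), SobolevBound r R w → SobolevBound r R v →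
      SobolevBound r δ (w - v) → SobolevBound r (K * δ) (w ^ m - v ^ m) := by
  induction m with
  | zero =>
    refine ⟨0, le_rfl, fun w v δ hw hv hd => ?_⟩
    -- The difference is the zero function; scaling any bounded function by `0` supplies its bound
    -- `0`.
    have h := hd.smul 0
    simpa using h
  | succ m ih =>
    obtain ⟨K, hK, ih⟩ := ih
    -- `R` gets a sign only once some function is bounded by it, hence the absolute values, which
    -- are removed at the end.
    refine ⟨algConst d r * (K * |R|) + algConst d r * |(algConst d r * R) ^ m|, ?_,
      fun w v δ hw hv hd => ?_⟩
    · have := algConst_nonneg d r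
      positivity
    have h1 := ((ih w v δ hw hv hd).mul hw hr).add ((hv.pow hr m).mul hd hr)
    have h2 : w ^ (m + 1) - v ^ (m + 1) = (w ^ m - v ^ m) * w + v ^ m * (w - v) := by ring
    rw [h2]
    refine h1.mono (le_of_eq ?_)
    rw [abs_of_nonneg hw.nonneg, abs_of_nonneg (hv.pow hr m).nonneg]
    ring

/-- One constant serves all contractive symbols, hence all times `σ` and all step sizes. -/
theorem multNonlin_sub_bound {r : ℝ} (hr : (d : ℝ) / 2 < r) (p : ℕ) (R : ℝ) :
    ∃ K, 0 ≤ K ∧ ∀ g, Contractive d g → ∀ (w v : Torus d → ℂ) (δ : ℝ),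
      SobolevBound r R w → SobolevBound r R v → SobolevBound r δ (w - v) →
      SobolevBound r (K * δ) (multNonlin p g w - multNonlin p g v) := by
  obtain ⟨K₁, hK₁, h₁⟩ := pow_sub_bound (d := d) hr (p + 1) R
  obtain ⟨K₂, hK₂, h₂⟩ := pow_sub_bound (d := d) hr p R
  have hC := algConst_nonneg d r
  refine ⟨algConst d r * (K₁ * |(algConst d r * R) ^ p|) +
    algConst d r * (|(algConst d r * R) ^ (p + 1)| * K₂), by positivity,
    fun g hg w v δ hw hv hd => ?_⟩
  have hP := (hw.star.pow hr p)
  have hQ := (hv.star.pow hr p)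
  have h3 := h₂ (star w) (star v) δ hw.star hv.star (by simpa using hd.star)
  have h4 := h3.multiplier hr hg
  rw [hP.multiplier_sub hQ hr hg] at h4
  have h5 := ((h₁ w v δ hw hv hd).mul (hP.multiplier hr hg) hr).add
    ((hv.pow hr (p + 1)).mul h4 hr)
  have h6 : multNonlin p g w - multNonlin p g v =
      (w ^ (p + 1) - v ^ (p + 1)) * laplaceMultiplier g (star w ^ p) +
      v ^ (p + 1) * (laplaceMultiplier g (star w ^ p) - laplaceMultiplier g (star v ^ p)) := by
    rw [multNonlin, multNonlin]
    ring
  rw [h6]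
  refine h5.mono (le_of_eq ?_)
  rw [abs_of_nonneg hP.nonneg, abs_of_nonneg (hv.pow hr (p + 1)).nonneg]
  ring

/-! ### Commuting the free flow with powers and with the nonlinearity -/

section Filtered

variable {r γ : ℝ}

/-- Induction with one commutator per factor; the estimate can be repeated because `w ^ m` remains
in the algebra `H^{r+γ}`. -/
theorem freeGroup_pow_sub_bound (hr : (d : ℝ) / 2 < r) (hγ0 : 0 ≤ γ) (hγ1 : γ ≤ 1) (m : ℕ) (M : ℝ) :
    ∃ K, 0 ≤ K ∧ ∀ (w : Torus d → ℂ) (t : ℝ), SobolevBound (r + γ) M w →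
      SobolevBound r (K * |t| ^ γ) (freeGroup t w ^ m - freeGroup t (w ^ m)) := by
  have hrγ : (d : ℝ) / 2 < r + γ := by linarith
  have hC := algConst_nonneg d r
  induction m with
  | zero =>
    refine ⟨0, le_rfl, fun w t hw => ?_⟩
    have h1 := SobolevBound.one (d := d) r
    have h2 : freeGroup t (1 : Torus d → ℂ) = 1 := by
      refine (h1.freeGroup hr t).ext_coeff h1 hr fun k => ?_
      rw [h1.coeff_freeGroup hr]
      change _ * coeff (fun _ => (1 : ℂ)) k = coeff (fun _ => (1 : ℂ)) k
      rw [coeff_one]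
      split_ifs with hk
      · simp [hk, phase, modeSq]
      · simp
    have h := h1.smul 0
    simpa [h2] using h
  | succ m ih =>
    obtain ⟨K, hK, ih⟩ := ih
    refine ⟨algConst d r * (K * |M|) +
      algConst d r * (4 * |(algConst d (r + γ) * M) ^ m| * |M|), by positivity, fun w t hw => ?_⟩
    have hw' := hw.of_le (s := r) (by linarith)
    have h1 := ((ih w t hw).mul (hw'.freeGroup hr t) hr).add
      ((hw.pow hrγ m).freeGroup_mul hr hγ0 hγ1 hw t)
    have h2 : freeGroup t w ^ (m + 1) - freeGroup t (w ^ (m + 1)) =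
        (freeGroup t w ^ m - freeGroup t (w ^ m)) * freeGroup t w +
        (freeGroup t (w ^ m) * freeGroup t w - freeGroup t (w ^ m * w)) := by
      rw [← pow_succ w]
      ring
    rw [h2]
    refine h1.mono (le_of_eq ?_)
    rw [abs_of_nonneg hw.nonneg, abs_of_nonneg (hw.pow hrγ m).nonneg]
    ring

/-- Three commutators: the power `w^{p+1}` at time `t` (`e1`), the power `w̄^p` at time `-t` (`e2`),
and, after writing `e^{-itΔ} = e^{itΔ} e^{-2itΔ}`, the product of the two (`e3`). The twist
`e^{-2itΔ}` does not enlarge the `H^{r+γ}` norm. -/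
theorem multNonlin_freeGroup_sub_bound (hr : (d : ℝ) / 2 < r) (hγ0 : 0 ≤ γ) (hγ1 : γ ≤ 1)
    (p : ℕ) (M : ℝ) :
    ∃ K, 0 ≤ K ∧ ∀ (w : Torus d → ℂ) (t : ℝ), SobolevBound (r + γ) M w →
      SobolevBound r (K * |t| ^ γ)
        (multNonlin p (expSymbol 0) (freeGroup t w) -
          freeGroup t (multNonlin p (expSymbol (-2 * t)) w)) := by
  have hrγ : (d : ℝ) / 2 < r + γ := by linarith
  have hC := algConst_nonneg d r
  obtain ⟨K₁, hK₁, h₁⟩ := freeGroup_pow_sub_bound (d := d) hr hγ0 hγ1 (p + 1) M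
  obtain ⟨K₂, hK₂, h₂⟩ := freeGroup_pow_sub_bound (d := d) hr hγ0 hγ1 p M
  set P := |(algConst d (r + γ) * M) ^ (p + 1)|
  set Q := |(algConst d (r + γ) * M) ^ p|
  set Q' := |(algConst d r * M) ^ p|
  refine ⟨algConst d r * (K₁ * Q') + algConst d r * (P * K₂) + algConst d r * (4 * P * Q),
    by positivity, fun w t hw => ?_⟩
  have hw' := hw.of_le (s := r) (by linarith)
  have hP := hw.pow hrγ (p + 1)
  have hQ := hw.star.pow hrγ p
  have hQr := (hw'.star.pow hr p)
  have hstar : star (freeGroup t w) = freeGroup (-t) (star w) := hw'.star_freeGroup hr t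
  have hSp := (hw'.star.freeGroup hr (-t)).pow hr p
  have e1 := (h₁ w t hw).mul hSp hr
  have e2 := (((hP.of_le (s := r) (by linarith)).freeGroup hr t).mul (h₂ (star w) (-t) hw.star) hr)
  have e3 := hP.freeGroup_mul hr hγ0 hγ1 (hQ.freeGroup hrγ (-2 * t)) t
  have h0 : laplaceMultiplier (expSymbol 0) (star (freeGroup t w) ^ p) =
      freeGroup (-t) (star w) ^ p := by
    rw [hstar]
    exact hSp.freeGroup_zero hr
  have h4 : freeGroup t (freeGroup (-2 * t) (star w ^ p)) = freeGroup (-t) (star w ^ p) := by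
    rw [hQr.freeGroup_freeGroup hr]
    congr 1
    ring
  have h5 : multNonlin p (expSymbol 0) (freeGroup t w) -
      freeGroup t (multNonlin p (expSymbol (-2 * t)) w) =
      (freeGroup t w ^ (p + 1) - freeGroup t (w ^ (p + 1))) * freeGroup (-t) (star w) ^ p +
      freeGroup t (w ^ (p + 1)) * (freeGroup (-t) (star w) ^ p - freeGroup (-t) (star w ^ p)) +
      (freeGroup t (w ^ (p + 1)) * freeGroup t (freeGroup (-2 * t) (star w ^ p)) -
        freeGroup t (w ^ (p + 1) * freeGroup (-2 * t) (star w ^ p))) := by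
    rw [multNonlin, h0, h4]
    change _ - freeGroup t (w ^ (p + 1) * freeGroup (-2 * t) (star w ^ p)) = _
    ring
  rw [h5]
  refine ((e1.add e2).add e3).mono (le_of_eq ?_)
  rw [abs_neg]
  simp only [P, Q, Q', abs_of_nonneg hP.nonneg, abs_of_nonneg hQ.nonneg, abs_of_nonneg hQr.nonneg]
  ring

end Filtered

/-! ### The integrator -/

/-- The symbol `z ↦ φ₁(-2iτz)`. -/
def filterSymbol (τ : ℝ) (z : ℂ) : ℂ := phi1 (-2 * Complex.I * τ * z)

theorem norm_phi1_le (θ : ℝ) : ‖phi1 (Complex.I * θ)‖ ≤ 1 := by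
  unfold phi1
  split_ifs with h
  · simp
  · rw [norm_div]
    refine div_le_one_of_le₀ ?_ (norm_nonneg _)
    simpa using Real.norm_exp_I_mul_ofReal_sub_one_le (x := θ)

theorem filterSymbol_eq (τ : ℝ) (k : Fin d → ℤ) :
    filterSymbol τ (-(modeSq k : ℂ)) = phi1 (Complex.I * ((2 * τ * modeSq k : ℝ) : ℂ)) := by
  rw [filterSymbol]
  congr 1
  push_cast
  ring

theorem contractive_filterSymbol (τ : ℝ) : Contractive d (filterSymbol τ) := fun k => by
  rw [filterSymbol_eq]
  exact norm_phi1_le _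

theorem step_eq (p : ℕ) (μ τ : ℝ) (w : Torus d → ℂ) :
    step p μ τ w = freeGroup τ (w - (Complex.I * μ * τ) • multNonlin p (filterSymbol τ) w) := by
  rw [step]
  congr 1
  funext x
  simp only [multNonlin, Pi.sub_apply, Pi.smul_apply, Pi.mul_apply, Pi.pow_apply, smul_eq_mul,
    ← mul_assoc]
  rfl

theorem integral_expSymbol (τ : ℝ) (k : Fin d → ℤ) :
    ∫ σ in (0 : ℝ)..τ, expSymbol (-2 * σ) (-(modeSq k : ℂ)) =
      τ * filterSymbol τ (-(modeSq k : ℂ)) := by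
  rw [filterSymbol_eq]
  have h : ∀ σ : ℝ, expSymbol (-2 * σ) (-(modeSq k : ℂ)) =
      Complex.exp (Complex.I * 2 * modeSq k * σ) := fun σ => by
    rw [expSymbol]
    congr 1
    push_cast
    ring
  simp_rw [h]
  -- The zero mode uses the value `φ₁(0) = 1`.
  rcases eq_or_ne (modeSq k) 0 with h0 | h0
  · simp [h0, phi1]
  rcases eq_or_ne τ 0 with hτ | hτ
  · simp [hτ]
  have h1 : (modeSq k : ℂ) ≠ 0 := by exact_mod_cast h0
  have h2 : (τ : ℂ) ≠ 0 := by exact_mod_cast hτ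
  rw [integral_exp_mul_complex (by simp [h1]), phi1, if_neg (by simp [h1, h2])]
  push_cast
  rw [mul_zero, Complex.exp_zero, show Complex.I * (2 * (τ : ℂ) * (modeSq k : ℂ)) =
    Complex.I * 2 * modeSq k * τ by ring]
  field_simp

/-- Isolates the symbol as a scalar in each term, so that continuity and integration in `σ` can be
handled termwise. -/
theorem coeff_multNonlin_hasSum {r R : ℝ} (hr : (d : ℝ) / 2 < r) (p : ℕ) {g : ℂ → ℂ}
    (hg : Contractive d g) {w : Torus d → ℂ} (hw : SobolevBound r R w) (k : Fin d → ℤ) :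
    HasSum (fun l => g (-(modeSq (k - l) : ℂ)) * (coeff (w ^ (p + 1)) l * coeff (star w ^ p) (k - l)))
      (coeff (multNonlin p g w) k) := by
  have h := (hw.pow hr (p + 1)).coeff_mul_hasSum ((hw.star.pow hr p).multiplier hr hg) hr k
  simp only [(hw.star.pow hr p).coeff_multiplier hr hg] at h
  refine h.congr_fun fun l => ?_
  ring

theorem coeff_multNonlin_summable {r R : ℝ} (hr : (d : ℝ) / 2 < r) (p : ℕ)
    {w : Torus d → ℂ} (hw : SobolevBound r R w) (k : Fin d → ℤ) :
    Summable fun l => ‖coeff (w ^ (p + 1)) l * coeff (star w ^ p) (k - l)‖ := by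
  simpa [norm_mul] using
    (hw.pow hr (p + 1)).seqBound.summable_conv (hw.star.pow hr p).seqBound hr k

theorem norm_expSymbol (t : ℝ) (k : Fin d → ℤ) : ‖expSymbol t (-(modeSq k : ℂ))‖ = 1 := by
  rw [expSymbol, freeGroup_symbol, norm_phase]

theorem continuous_expSymbol (z : ℂ) : Continuous fun σ : ℝ => expSymbol (-2 * σ) z := by
  unfold expSymbol
  fun_prop

theorem continuous_coeff_multNonlin {r R : ℝ} (hr : (d : ℝ) / 2 < r) (p : ℕ)
    {w : Torus d → ℂ} (hw : SobolevBound r R w) (k : Fin d → ℤ) :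
    Continuous fun σ : ℝ => coeff (multNonlin p (expSymbol (-2 * σ)) w) k := by
  simp_rw [← fun σ : ℝ =>
    (coeff_multNonlin_hasSum hr p (contractive_expSymbol (-2 * σ)) hw k).tsum_eq]
  refine continuous_tsum (fun l => (continuous_expSymbol _).mul continuous_const)
    (coeff_multNonlin_summable hr p hw k) fun l σ => ?_
  rw [norm_mul, norm_expSymbol, one_mul]

/-- The filter in the scheme is the exact time average of the frozen integrand, so no quadrature
error arises here. -/
theorem integral_coeff_multNonlin {r R : ℝ} (hr : (d : ℝ) / 2 < r) (p : ℕ)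
    {w : Torus d → ℂ} (hw : SobolevBound r R w) (τ : ℝ) (k : Fin d → ℤ) :
    ∫ σ in (0 : ℝ)..τ, coeff (multNonlin p (expSymbol (-2 * σ)) w) k =
      τ * coeff (multNonlin p (filterSymbol τ) w) k := by
  have hsum := coeff_multNonlin_summable hr p hw k
  have h := intervalIntegral.hasSum_integral_of_dominated_convergence (μ := volume)
    (a := 0) (b := τ)
    (F := fun (l : Fin d → ℤ) (σ : ℝ) => expSymbol (-2 * σ) (-(modeSq (k - l) : ℂ)) *
      (coeff (w ^ (p + 1)) l * coeff (star w ^ p) (k - l)))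
    (f := fun σ => coeff (multNonlin p (expSymbol (-2 * σ)) w) k)
    (fun l _ => ‖coeff (w ^ (p + 1)) l * coeff (star w ^ p) (k - l)‖)
    (fun l => ((continuous_expSymbol _).mul continuous_const).aestronglyMeasurable)
    (fun l => ae_of_all _ fun σ _ => by rw [norm_mul, norm_expSymbol, one_mul])
    (ae_of_all _ fun σ _ => hsum) intervalIntegrable_const
    (ae_of_all _ fun σ _ => coeff_multNonlin_hasSum hr p (contractive_expSymbol _) hw k)
  simp only [intervalIntegral.integral_mul_const, integral_expSymbol, mul_assoc] at h
  exact h.unique ((coeff_multNonlin_hasSum hr p (contractive_filterSymbol τ) hw k).mul_left _)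

/-- Equality holds everywhere: the outer multiplier sees its argument only through Fourier
coefficients. -/
theorem step_congr_ae {w v : Torus d → ℂ} (h : w =ᵐ[torusMeasure d] v) (p : ℕ) (μ τ : ℝ) :
    step p μ τ w = step p μ τ v := by
  have h1 : (fun y => (starRingEnd ℂ) (w y) ^ p) =ᵐ[torusMeasure d]
      fun y => (starRingEnd ℂ) (v y) ^ p := by
    filter_upwards [h] with x hx
    rw [hx]
  unfold step
  refine freeGroup_congr_ae ?_ τ
  rw [laplaceMultiplier_eq_synth, laplaceMultiplier_eq_synth, coeff_congr_ae h1]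
  filter_upwards [h] with x hx
  rw [hx]

/-- The free flow does not enlarge the norm, so only the nonlinear term, of size `τ`, contributes to
the growth. -/
theorem step_sub_bound {r : ℝ} (hr : (d : ℝ) / 2 < r) (p : ℕ) (μ R : ℝ) :
    ∃ L, 0 ≤ L ∧ ∀ (w v : Torus d → ℂ) (δ τ : ℝ), 0 ≤ τ → SobolevBound r R w →
      SobolevBound r R v → SobolevBound r δ (w - v) →
      SobolevBound r ((1 + L * τ) * δ) (step p μ τ w - step p μ τ v) := by
  obtain ⟨K, hK, h⟩ := multNonlin_sub_bound (d := d) hr p R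
  obtain ⟨K', h'⟩ := multNonlin_bound (d := d) hr p R
  refine ⟨|μ| * K, by positivity, fun w v δ τ hτ hw hv hd => ?_⟩
  have hg := contractive_filterSymbol (d := d) τ
  have e := hd.sub ((h _ hg w v δ hw hv hd).smul (Complex.I * μ * τ))
  rw [step_eq, step_eq, ← (hw.sub ((h' _ hg w hw).smul _)).freeGroup_sub
    (hv.sub ((h' _ hg v hv).smul _)) hr]
  rw [show w - v - (Complex.I * μ * τ) •
      (multNonlin p (filterSymbol τ) w - multNonlin p (filterSymbol τ) v) =
      w - (Complex.I * μ * τ) • multNonlin p (filterSymbol τ) w -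
      (v - (Complex.I * μ * τ) • multNonlin p (filterSymbol τ) v) by rw [smul_sub]; abel] at e
  refine (e.freeGroup hr τ).mono (le_of_eq ?_)
  simp only [norm_mul, Complex.norm_I, Complex.norm_real, Real.norm_eq_abs, abs_of_nonneg hτ]
  ring

/-! ### Comparison with `MemSobolev` -/

theorem MemSobolev.seqBound {s M : ℝ} {f : Torus d → ℂ} (hf : MemSobolev s f)
    (hM : sobolevNorm s f ≤ M) : SeqBound s M fun k => ‖coeff f k‖ := by
  refine SeqBound.mono ⟨Real.sqrt_nonneg _, fun F => ?_⟩ hM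
  have h0 : ∀ k, 0 ≤ sobolevWeight s k * ‖coeff f k‖ ^ 2 := fun k => by
    rw [sobolevWeight_eq]
    positivity
  rw [Real.sq_sqrt (tsum_nonneg h0)]
  refine le_of_eq_of_le (Finset.sum_congr rfl fun k _ => ?_) (hf.2.sum_le_tsum F fun k _ => h0 k)
  rw [sobolevWeight_eq, mul_pow]

theorem MemSobolev.summable_coeff {s : ℝ} {f : Torus d → ℂ} (hf : MemSobolev s f)
    (hs : (d : ℝ) / 2 < s) : Summable fun k => ‖coeff f k‖ := by
  simpa using (hf.seqBound le_rfl).summable hs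

theorem MemSobolev.synth_ae_eq {s : ℝ} {f : Torus d → ℂ} (hf : MemSobolev s f)
    (hs : (d : ℝ) / 2 < s) : synth (coeff f) =ᵐ[torusMeasure d] f :=
  synth_coeff_ae_eq hf.1 (hf.summable_coeff hs)

theorem MemSobolev.sobolevBound_synth {s M : ℝ} {f : Torus d → ℂ} (hf : MemSobolev s f)
    (hs : (d : ℝ) / 2 < s) (hM : sobolevNorm s f ≤ M) :
    SobolevBound s M (synth (coeff f)) := by
  refine ⟨continuous_synth (hf.summable_coeff hs), ?_⟩
  rw [coeff_congr_ae (hf.synth_ae_eq hs)]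
  exact hf.seqBound hM

namespace SobolevBound

variable {s A : ℝ} {f h : Torus d → ℂ}

theorem memSobolev_of_ae (hf : SobolevBound s A f) (hh : h =ᵐ[torusMeasure d] f) :
    MemSobolev s h := by
  refine ⟨(memLp_congr_ae hh).mpr (hf.continuous.memLp_torus 2), ?_⟩
  rw [coeff_congr_ae hh]
  refine summable_of_sum_le (c := A ^ 2) (fun k => ?_) fun F =>
    le_of_eq_of_le (Finset.sum_congr rfl fun k _ => ?_) (hf.seqBound.sum_le F)
  · rw [sobolevWeight_eq]
    positivity
  · rw [sobolevWeight_eq, mul_pow]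

theorem sobolevNorm_le_of_ae (hf : SobolevBound s A f) (hh : h =ᵐ[torusMeasure d] f) :
    sobolevNorm s h ≤ A := by
  rw [sobolevNorm, coeff_congr_ae hh, Real.sqrt_le_iff]
  refine ⟨hf.nonneg, ?_⟩
  refine Real.tsum_le_of_sum_le (fun k => ?_) fun F =>
    le_of_eq_of_le (Finset.sum_congr rfl fun k _ => ?_) (hf.seqBound.sum_le F)
  · rw [sobolevWeight_eq]
    positivity
  · rw [sobolevWeight_eq, mul_pow]

theorem norm_coeff_le (hf : SobolevBound s A f) (hs : 0 ≤ s) (k : Fin d → ℤ) : ‖coeff f k‖ ≤ A := by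
  simpa using hf.seqBound.abs_le hs k

end SobolevBound

/-! ### Mild solutions through continuous representatives -/

/-- A mild solution with continuous values, bounded by `M` in `H^s`, whose nonlinearity has
continuous Fourier coefficients. -/
structure MildSolution (p : ℕ) (μ s T M : ℝ) (U : ℝ → Torus d → ℂ) : Prop where
  bound : ∀ t ∈ Set.Icc 0 T, SobolevBound s M (U t)
  continuousOn : ∀ k, ContinuousOn (fun σ => coeff (nonlinearity p (U σ)) k) (Set.Icc 0 T)
  duhamel : ∀ t ∈ Set.Icc 0 T, ∀ k, coeff (U t) k = phase t k * coeff (U 0) k -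
    Complex.I * μ * ∫ σ in (0 : ℝ)..t, phase (t - σ) k * coeff (nonlinearity p (U σ)) k

theorem nonlinearity_congr_ae {f h : Torus d → ℂ} (H : f =ᵐ[torusMeasure d] h) (p : ℕ) :
    nonlinearity p f =ᵐ[torusMeasure d] nonlinearity p h := by
  filter_upwards [H] with x hx
  rw [nonlinearity, nonlinearity, hx]

/-- Replaces each `u t` by its continuous representative. Continuity in `H^r` and the Lipschitz
bound make the coefficients of the nonlinearity continuous in time, which provides integrability
later. -/
theorem IsSolution.mildSolution {p : ℕ} {μ r γ T M : ℝ} (hr : (d : ℝ) / 2 < r) (hγ : 0 ≤ γ)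
    (hT : 0 ≤ T) {u : ℝ → Torus d → ℂ} (hu : IsSolution p μ r T u)
    (hM : ∀ t ∈ Set.Icc 0 T, MemSobolev (r + γ) (u t) ∧ sobolevNorm (r + γ) (u t) ≤ M) :
    MildSolution p μ (r + γ) T M fun t => synth (coeff (u t)) := by
  have hrγ : (d : ℝ) / 2 < r + γ := by linarith
  have hd : (0 : ℝ) ≤ d := Nat.cast_nonneg d
  have hbound : ∀ t ∈ Set.Icc 0 T, SobolevBound (r + γ) M (synth (coeff (u t))) := fun t ht =>
    (hM t ht).1.sobolevBound_synth hrγ (hM t ht).2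
  have hr' : ∀ t ∈ Set.Icc 0 T, SobolevBound r M (synth (coeff (u t))) := fun t ht =>
    (hbound t ht).of_le (by linarith)
  have hae : ∀ t ∈ Set.Icc 0 T, synth (coeff (u t)) =ᵐ[torusMeasure d] u t := fun t ht =>
    (hu.mem t ht).synth_ae_eq hr
  obtain ⟨K, hK⟩ := multNonlin_bound (d := d) hr p M
  obtain ⟨L, hL0, hL⟩ := multNonlin_sub_bound (d := d) hr p M
  have hN : ∀ t ∈ Set.Icc 0 T, SobolevBound r K (nonlinearity p (synth (coeff (u t)))) :=
    fun t ht => by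
      rw [nonlinearity_eq (hr' t ht) hr]
      exact hK _ (contractive_expSymbol 0) _ (hr' t ht)
  refine ⟨hbound, fun k t ht => ?_, fun t ht k => ?_⟩
  · rw [ContinuousWithinAt, tendsto_iff_norm_sub_tendsto_zero]
    have h0 := (hu.continuous t ht).const_mul L
    rw [mul_zero] at h0
    refine squeeze_zero' (Eventually.of_forall fun _ => norm_nonneg _) ?_ h0
    filter_upwards [self_mem_nhdsWithin] with t' ht'
    rw [← coeff_sub (hN t' ht').integrable (hN t ht).integrable]
    have hsub := (hr' t' ht').sub (hr' t ht)
    have hae' : u t' - u t =ᵐ[torusMeasure d] synth (coeff (u t')) - synth (coeff (u t)) :=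
      ((hae t' ht').sub (hae t ht)).symm
    have h1 : SobolevBound r (sobolevNorm r (u t' - u t))
        (synth (coeff (u t')) - synth (coeff (u t))) := by
      refine ⟨hsub.continuous, ?_⟩
      rw [← coeff_congr_ae hae']
      exact (hsub.memSobolev_of_ae hae').seqBound le_rfl
    rw [nonlinearity_eq (hr' t' ht') hr, nonlinearity_eq (hr' t ht) hr]
    exact (hL _ (contractive_expSymbol 0) _ _ _ (hr' t' ht') (hr' t ht) h1).norm_coeff_le
      (by linarith) k
  · have h0 : (0 : ℝ) ∈ Set.Icc 0 T := ⟨le_rfl, hT⟩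
    rw [coeff_congr_ae (hae t ht), hu.duhamel t ht k, ← freeGroup_congr_ae (hae 0 h0),
      (hr' 0 h0).coeff_freeGroup hr]
    congr 2
    refine intervalIntegral.integral_congr fun σ hσ => ?_
    rw [Set.uIcc_of_le ht.1] at hσ
    have hσ' : σ ∈ Set.Icc 0 T := ⟨hσ.1, hσ.2.trans ht.2⟩
    rw [← (hN σ hσ').coeff_freeGroup hr,
      freeGroup_congr_ae (nonlinearity_congr_ae (hae σ hσ') p)]

namespace MildSolution

variable {p : ℕ} {μ s T M : ℝ} {U : ℝ → Torus d → ℂ}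

theorem continuousOn_integrand (hU : MildSolution p μ s T M U) (k : Fin d → ℤ) (a : ℝ) :
    ContinuousOn (fun σ => phase (a - σ) k * coeff (nonlinearity p (U σ)) k) (Set.Icc 0 T) :=
  (((continuous_phase k).comp (continuous_const.sub continuous_id)).continuousOn).mul
    (hU.continuousOn k)

theorem intervalIntegrable (hU : MildSolution p μ s T M U) (k : Fin d → ℤ) (a : ℝ) {x y : ℝ}
    (hx : 0 ≤ x) (hxy : x ≤ y) (hy : y ≤ T) :
    IntervalIntegrable (fun σ => phase (a - σ) k * coeff (nonlinearity p (U σ)) k) volume x y := by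
  refine ContinuousOn.intervalIntegrable ((hU.continuousOn_integrand k a).mono ?_)
  rw [Set.uIcc_of_le hxy]
  exact Set.Icc_subset_Icc hx hy

/-- Duhamel's formula restarted at time `t`, from the group property of the phases and a translation
of the integral. -/
theorem coeff_add (hU : MildSolution p μ s T M U) {t τ : ℝ} (ht : 0 ≤ t) (hτ : 0 ≤ τ)
    (hT : t + τ ≤ T) (k : Fin d → ℤ) :
    coeff (U (t + τ)) k = phase τ k * coeff (U t) k -
      Complex.I * μ * ∫ σ in (0 : ℝ)..τ,
        phase (τ - σ) k * coeff (nonlinearity p (U (t + σ))) k := by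
  have h1 := hU.duhamel (t + τ) ⟨by linarith, hT⟩ k
  have h2 := hU.duhamel t ⟨ht, by linarith⟩ k
  have h3 : ∫ σ in (0 : ℝ)..τ, phase (τ - σ) k * coeff (nonlinearity p (U (t + σ))) k =
      ∫ σ in t..(t + τ), phase (t + τ - σ) k * coeff (nonlinearity p (U σ)) k := by
    have := intervalIntegral.integral_comp_add_left (a := 0) (b := τ)
      (fun σ => phase (t + τ - σ) k * coeff (nonlinearity p (U σ)) k) t
    rw [add_zero] at this
    rw [← this]
    simp only [add_sub_add_left_eq_sub]
  have h4 : ∫ σ in (0 : ℝ)..t, phase (t + τ - σ) k * coeff (nonlinearity p (U σ)) k =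
      phase τ k * ∫ σ in (0 : ℝ)..t, phase (t - σ) k * coeff (nonlinearity p (U σ)) k := by
    rw [← intervalIntegral.integral_const_mul]
    congr 1
    funext σ
    rw [show t + τ - σ = τ + (t - σ) by ring, phase_add, mul_assoc]
  rw [h1, h2, h3, ← intervalIntegral.integral_add_adjacent_intervals
    (hU.intervalIntegrable k _ le_rfl ht (by linarith))
    (hU.intervalIntegrable k _ ht (by linarith) hT), h4, add_comm t τ, phase_add]
  ring

theorem intervalIntegrable_shift (hU : MildSolution p μ s T M U) {t τ : ℝ} (ht : 0 ≤ t)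
    (hτ : 0 ≤ τ) (hT : t + τ ≤ T) (k : Fin d → ℤ) :
    IntervalIntegrable (fun σ => phase (τ - σ) k * coeff (nonlinearity p (U (t + σ))) k)
      volume 0 τ := by
  refine ContinuousOn.intervalIntegrable ?_
  rw [Set.uIcc_of_le hτ]
  refine (((continuous_phase k).comp (continuous_const.sub continuous_id)).continuousOn).mul
    ((hU.continuousOn k).comp (continuous_const.add continuous_id).continuousOn fun σ hσ => ?_)
  exact ⟨add_nonneg ht hσ.1, le_trans (by simpa using hσ.2) hT⟩

end MildSolution

/-! ### Local and global error -/

/-- By Duhamel, the deviation from the free flow is an integral over length `τ` of a bounded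
integrand; no regularity beyond `H^r` is spent. -/
theorem increment_bound {r : ℝ} (hr : (d : ℝ) / 2 < r) (p : ℕ) (μ M : ℝ) :
    ∃ K, 0 ≤ K ∧ ∀ (s T : ℝ) (U : ℝ → Torus d → ℂ), r ≤ s → MildSolution p μ s T M U →
      ∀ t τ : ℝ, 0 ≤ t → 0 ≤ τ → t + τ ≤ T →
        SobolevBound r (K * τ) (U (t + τ) - freeGroup τ (U t)) := by
  obtain ⟨K, hK⟩ := multNonlin_bound (d := d) hr p M
  refine ⟨|μ| * |K|, by positivity, fun s T U hrs hU t τ ht hτ hT => ?_⟩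
  have hb : ∀ t ∈ Set.Icc 0 T, SobolevBound r M (U t) := fun t ht => (hU.bound t ht).of_le hrs
  have h1 := hb (t + τ) ⟨by linarith, hT⟩
  have h2 := hb t ⟨ht, by linarith⟩
  have h3 := h2.freeGroup hr τ
  refine ⟨(h1.sub h3).continuous, ?_⟩
  have h4 := (SeqBound.intervalIntegral (s := r) hτ (abs_nonneg K)
    (fun k => hU.intervalIntegrable_shift ht hτ hT k) fun σ hσ => ?_).const_mul (abs_nonneg μ)
  · refine (h4.of_abs_le fun k => le_of_eq ?_).mono (le_of_eq (by ring))
    rw [coeff_sub h1.integrable h3.integrable, h2.coeff_freeGroup hr, hU.coeff_add ht hτ hT,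
      sub_sub_cancel_left, norm_neg, norm_mul, norm_mul, Complex.norm_I, one_mul,
      Complex.norm_real, Real.norm_eq_abs]
  · have h5 := hb (t + σ) ⟨add_nonneg ht hσ.1, by linarith [hσ.2]⟩
    have h6 := (hK _ (contractive_expSymbol 0) _ h5).mono (le_abs_self K)
    rw [← nonlinearity_eq h5 hr] at h6
    refine h6.seqBound.of_abs_le fun k => le_of_eq ?_
    rw [norm_mul, norm_phase, one_mul]

/-- Solution and step are written as integrals over the same interval, so that the integrands can be
compared at each `σ`: first freeze the solution to its free flow, then pull the flow out. -/
theorem local_error_bound {r γ : ℝ} (hr : (d : ℝ) / 2 < r) (hγ0 : 0 ≤ γ) (hγ1 : γ ≤ 1) (p : ℕ)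
    (μ M : ℝ) :
    ∃ K, 0 ≤ K ∧ ∀ (T : ℝ) (U : ℝ → Torus d → ℂ), MildSolution p μ (r + γ) T M U →
      ∀ t τ : ℝ, 0 ≤ t → 0 ≤ τ → τ ≤ 1 → t + τ ≤ T →
        SobolevBound r (τ * (K * τ ^ γ)) (U (t + τ) - step p μ τ (U t)) := by
  obtain ⟨K₀, hK₀, h₀⟩ := increment_bound (d := d) hr p μ M
  obtain ⟨K₁, hK₁, h₁⟩ := multNonlin_freeGroup_sub_bound (d := d) hr hγ0 hγ1 p M
  obtain ⟨K₂, h₂⟩ := multNonlin_bound (d := d) hr p M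
  obtain ⟨L, hL, hLip⟩ := multNonlin_sub_bound (d := d) hr p M
  refine ⟨|μ| * (L * K₀ + K₁), by positivity, fun T U hU t τ ht hτ hτ1 hT => ?_⟩
  have hb : ∀ t ∈ Set.Icc 0 T, SobolevBound r M (U t) := fun t ht =>
    (hU.bound t ht).of_le (by linarith)
  have hw := hb t ⟨ht, by linarith⟩
  have hw' := hU.bound t ⟨ht, by linarith⟩
  set w := U t with hw_def
  have hUτ := hb (t + τ) ⟨by linarith, hT⟩
  have hmf := h₂ _ (contractive_filterSymbol τ) w hw
  have hin := hw.sub (hmf.smul (Complex.I * μ * τ))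
  have hstep := hin.freeGroup hr τ
  rw [step_eq]
  refine ⟨(hUτ.sub hstep).continuous, ?_⟩
  have hcont := continuous_coeff_multNonlin hr p hw
  have hint : ∀ k, IntervalIntegrable
      (fun σ => phase τ k * coeff (multNonlin p (expSymbol (-2 * σ)) w) k) volume 0 τ := fun k =>
    (continuous_const.mul (hcont k)).intervalIntegrable _ _
  have hτγ : 0 ≤ (L * K₀ + K₁) * τ ^ γ := by positivity
  have h4 := (SeqBound.intervalIntegral (s := r) hτ hτγ
    (fun k => (hU.intervalIntegrable_shift ht hτ hT k).sub (hint k)) fun σ hσ => ?_).const_mul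
      (abs_nonneg μ)
  · refine (h4.of_abs_le fun k => le_of_eq ?_).mono (le_of_eq (by ring))
    rw [intervalIntegral.integral_sub (hU.intervalIntegrable_shift ht hτ hT k) (hint k),
      intervalIntegral.integral_const_mul, integral_coeff_multNonlin hr p hw,
      coeff_sub hUτ.integrable hstep.integrable, hin.coeff_freeGroup hr,
      coeff_sub hw.integrable (hmf.smul _).integrable, coeff_smul, hU.coeff_add ht hτ hT]
    rw [show ∀ a b c e : ℂ, a * b - Complex.I * μ * c - a * (b - Complex.I * μ * τ * e) =
      -(Complex.I * μ * (c - a * (τ * e))) by intros; ring]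
    rw [norm_neg, norm_mul, norm_mul, Complex.norm_I, one_mul, Complex.norm_real,
      Real.norm_eq_abs]
  · have hUσ := hb (t + σ) ⟨add_nonneg ht hσ.1, by linarith [hσ.2]⟩
    have hmσ := h₂ _ (contractive_expSymbol (-2 * σ)) w hw
    have hNσ := h₂ _ (contractive_expSymbol 0) _ hUσ
    have e1 := hLip _ (contractive_expSymbol 0) _ _ _ hUσ (hw.freeGroup hr σ)
      (h₀ _ T U (by linarith) hU t σ ht hσ.1 (by linarith [hσ.2]))
    have e2 := e1.add (h₁ w σ hw')
    rw [sub_add_sub_cancel, abs_of_nonneg hσ.1] at e2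
    have hσγ : σ ^ γ ≤ τ ^ γ := Real.rpow_le_rpow hσ.1 hσ.2 hγ0
    -- Here `τ ≤ 1` enters: it absorbs the first-order freezing error into `τ ^ γ`.
    have hσ1 : σ ≤ σ ^ γ := by
      rcases hσ.1.eq_or_lt with h0 | h0
      · rw [← h0]
        positivity
      · simpa using Real.rpow_le_rpow_of_exponent_ge h0 (hσ.2.trans hτ1) hγ1
    have e3 := e2.mono (B := (L * K₀ + K₁) * τ ^ γ) (by
      rw [add_mul, mul_assoc L K₀]
      gcongr
      exact hσ1.trans hσγ)
    refine e3.seqBound.of_abs_le fun k => le_of_eq ?_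
    rw [coeff_sub hNσ.integrable (hmσ.freeGroup hr σ).integrable, hmσ.coeff_freeGroup hr,
      nonlinearity_eq hUσ hr]
    -- Splitting the phase exposes the common unimodular factor `phase (τ - σ) k`, which drops out
    -- of the norm.
    have hph : phase τ k = phase (τ - σ) k * phase σ k := by
      rw [← phase_add, sub_add_cancel]
    rw [hph, mul_assoc, ← mul_sub, norm_mul, norm_phase, one_mul]

/-- Discrete Gronwall. The bound on the error and the confinement to the ball of radius `M + 1`,
where the Lipschitz constant is valid, must be propagated together. -/
theorem global_error_bound {r γ : ℝ} (hr : (d : ℝ) / 2 < r) (hγ0 : 0 ≤ γ) (hγ1 : γ ≤ 1) (p : ℕ)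
    (μ T M : ℝ) :
    ∃ C, 0 < C ∧ ∀ U : ℝ → Torus d → ℂ, MildSolution p μ (r + γ) T M U →
      ∀ τ : ℝ, 0 ≤ τ → τ ≤ 1 → C * τ ^ γ ≤ 1 → ∀ n : ℕ, n * τ ≤ T →
        SobolevBound r (M + 1) (numSol p μ τ (U 0) n) ∧
        SobolevBound r (C * τ ^ γ) (U (n * τ) - numSol p μ τ (U 0) n) := by
  obtain ⟨K, hK, hloc⟩ := local_error_bound (d := d) hr hγ0 hγ1 p μ M
  obtain ⟨L, hL, hstab⟩ := step_sub_bound (d := d) hr p μ (M + 1)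
  -- The exponential is the Gronwall factor; the `+ 1` ensures that the constant is positive.
  refine ⟨K * |T| * Real.exp (L * |T|) + 1, by positivity, fun U hU τ hτ hτ1 hC n hn => ?_⟩
  have hτγ : 0 ≤ τ ^ γ := by positivity
  have hb : ∀ t ∈ Set.Icc 0 T, SobolevBound r M (U t) := fun t ht =>
    (hU.bound t ht).of_le (by linarith)
  have hle : ∀ n : ℕ, n * τ ≤ T → K * τ ^ γ * (n * τ) * Real.exp (L * (n * τ)) ≤
      (K * |T| * Real.exp (L * |T|) + 1) * τ ^ γ := by
    intro n hn
    have hn' : n * τ ≤ |T| := hn.trans (le_abs_self T)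
    calc _ ≤ K * τ ^ γ * |T| * Real.exp (L * |T|) := by gcongr
      _ ≤ _ := by nlinarith
  -- The time-dependent bound is what the induction can reproduce; `hle` makes it uniform.
  have key : ∀ n : ℕ, n * τ ≤ T →
      SobolevBound r (K * τ ^ γ * (n * τ) * Real.exp (L * (n * τ)))
        (U (n * τ) - numSol p μ τ (U 0) n) := by
    intro n
    induction n with
    | zero =>
      intro h0
      have h := (hb 0 ⟨le_rfl, by simpa using h0⟩).smul 0
      simpa [numSol] using h
    | succ n ih =>
      intro hn
      push_cast at hn ⊢
      have hnτ : 0 ≤ n * τ := by positivity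
      have hn1 : n * τ + τ ≤ T := by linarith
      have hn2 : n * τ ≤ T := by linarith
      have e := ih hn2
      have hUn := hb (n * τ) ⟨hnτ, hn2⟩
      have hnum := hUn.sub e
      rw [sub_sub_cancel] at hnum
      -- The error so far is at most `C τ^γ ≤ 1`, so the iterate lies in the ball on which `L` was
      -- chosen.
      have hnum' := hnum.mono (B := M + 1) (by linarith [hle n hn2])
      have e1 := (hloc T U hU (n * τ) τ hnτ hτ hτ1 hn1).add
        (hstab _ _ _ τ hτ (hUn.mono (by linarith)) hnum' e)
      rw [sub_add_sub_cancel, show n * τ + τ = (n + 1) * τ by ring] at e1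
      refine e1.mono ?_
      have h1 : 1 + L * τ ≤ Real.exp (L * τ) := by
        linarith [Real.add_one_le_exp (L * τ)]
      have h2 : (1 : ℝ) ≤ Real.exp (L * ((n + 1) * τ)) := Real.one_le_exp (by positivity)
      have h3 : Real.exp (L * ((n + 1) * τ)) = Real.exp (L * τ) * Real.exp (L * (n * τ)) := by
        rw [← Real.exp_add]
        congr 1
        ring
      calc τ * (K * τ ^ γ) + (1 + L * τ) * (K * τ ^ γ * (n * τ) * Real.exp (L * (n * τ)))
          ≤ τ * (K * τ ^ γ) * Real.exp (L * ((n + 1) * τ)) +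
            Real.exp (L * τ) * (K * τ ^ γ * (n * τ) * Real.exp (L * (n * τ))) := by
            exact add_le_add (le_mul_of_one_le_right (by positivity) h2)
              (mul_le_mul_of_nonneg_right h1 (by positivity))
        _ = _ := by
            rw [h3]
            ring
  have e := (key n hn).mono (hle n hn)
  refine ⟨?_, e⟩
  have hnum := (hb (n * τ) ⟨by positivity, hn⟩).sub e
  rw [sub_sub_cancel] at hnum
  exact hnum.mono (by linarith)

theorem numSol_ae_eq {w v : Torus d → ℂ} (h : w =ᵐ[torusMeasure d] v) (p : ℕ) (μ τ : ℝ) (n : ℕ) :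
    numSol p μ τ w n =ᵐ[torusMeasure d] numSol p μ τ v n := by
  induction n with
  | zero => exact h
  | succ n ih =>
    rw [numSol, numSol, step_congr_ae ih]

end NLS

end

theorem mainTheorem2 (d p : ℕ) (hd : 1 ≤ d) (hp : 1 ≤ p) (μ r γ : ℝ) (hr : (d : ℝ) / 2 < r)
    (hγ0 : 0 < γ) (hγ1 : γ ≤ 1) (T : ℝ) (hT : 0 ≤ T) (M : ℝ) :
    ∃ c > (0 : ℝ), ∃ τ₀ > (0 : ℝ), ∀ u : ℝ → NLS.Torus d → ℂ,
      NLS.IsSolution p μ r T u →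
      (∀ t ∈ Set.Icc 0 T, NLS.MemSobolev (r + γ) (u t) ∧ NLS.sobolevNorm (r + γ) (u t) ≤ M) →
      ∀ τ : ℝ, 0 < τ → τ ≤ τ₀ → ∀ n : ℕ, (n : ℝ) * τ ≤ T →
        NLS.MemSobolev r (NLS.numSol p μ τ (u 0) n) ∧
        NLS.sobolevNorm r (u ((n : ℝ) * τ) - NLS.numSol p μ τ (u 0) n) ≤ c * τ ^ γ := by
  obtain ⟨C, hC, h⟩ := NLS.global_error_bound (d := d) hr hγ0.le hγ1 p μ T M
  -- The `1` is required by the local error; `C^{-1/γ}` is the step size at which `C τ^γ = 1`.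
  refine ⟨C, hC, min 1 (C⁻¹ ^ γ⁻¹), by positivity, fun u hu hM τ hτ hτ₀ n hn => ?_⟩
  have hτC : C * τ ^ γ ≤ 1 := by
    have h1 : τ ^ γ ≤ C⁻¹ :=
      (Real.rpow_le_rpow hτ.le (hτ₀.trans (min_le_right _ _)) hγ0.le).trans_eq
        (Real.rpow_inv_rpow (inv_nonneg.mpr hC.le) hγ0.ne')
    calc C * τ ^ γ ≤ C * C⁻¹ := by gcongr
      _ = 1 := mul_inv_cancel₀ hC.ne'
  obtain ⟨h1, h2⟩ := h _ (hu.mildSolution hr hγ0.le hT hM) τ hτ.le (hτ₀.trans (min_le_left _ _))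
    hτC n hn
  have hae : ∀ t ∈ Set.Icc 0 T, u t =ᵐ[NLS.torusMeasure d] NLS.synth (NLS.coeff (u t)) :=
    fun t ht => ((hu.mem t ht).synth_ae_eq hr).symm
  -- The estimates concern continuous representatives; almost-everywhere equality carries them back
  -- to `u` and to its numerical solution.
  have hnum := NLS.numSol_ae_eq (hae 0 ⟨le_rfl, hT⟩) p μ τ n
  exact ⟨h1.memSobolev_of_ae hnum, h2.sobolevNorm_le_of_ae
    ((hae _ ⟨by positivity, hn⟩).sub hnum)⟩
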